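/- **Setting.** There are $n$ clients; $\mathcal G\subseteq[n]$ is the set of regular ones, $G=|\mathcal G|\ge 1$, and the fraction of Byzantine clients is $\delta_{\rm byz}=(n-G)/n$. Let $f_i:\mathbb R^d\to\mathbb R$, $i\in\mathcal G$, be differentiable with $L$-Lipschitz gradients ($L>0$), $f=\frac1G\sum_{i\in\mathcal G}f_i$ and $f^\star=\inf f>-\infty$. Client $i$ has stochastic gradients $\nabla f_i(x,\xi)$ with $\mathbb E\nabla f_i(x,\xi)=\nabla f_i(x)$ and $\mathbb E\exp(\|\nabla f_i(x,\xi)-\nabla f_i(x)\|^2/\sigma^2)\le e$ for all $x$, where $\sigma\ge0$ (for $\sigma=0$: no noise). **Algorithm (Byz-Clip21-SGD2M)** with step size $\gamma>0$, momenta $\beta,\hat\beta\in(0,1]$, clipping level $\tau>0$, privacy noise level $\sigma_\omega$ and a $(\delta_{\rm byz},c)$-robust aggregator ${\rm RAgg}$, i.e. for all $x_1,\dots,x_n$ and all $S\subseteq[n]$ with $|S|=G$, $\|{\rm RAgg}(x_1,\dots,x_n)-\bar x_S\|^2\le \frac{c\,\delta_{\rm byz}}{G}\sum_{i\in S}\|x_i-\bar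 x_S\|^2$, $\bar x_S=\frac1G\sum_{i\in S}x_i$. Start from $x^0$ and $v_i^0=g_i^0=m_i^0=0$. For $t=0,1,\dots,T-1$ put $x^{t+1}=x^t-\gamma\,{\rm RAgg}(m_1^t,\dots,m_n^t)$; for $i\in\mathcal G$ put $v_i^{t+1}=(1-\beta)v_i^t+\beta\nabla f_i(x^{t+1},\xi_i^{t+1})$, $c_i^{t+1}={\rm clip}_\tau(v_i^{t+1}-g_i^t)+\omega_i^{t+1}$ and $g_i^{t+1}=g_i^t+\hat\beta\,{\rm clip}_\tau(v_i^{t+1}-g_i^t)$, with independent samples $\xi_i^{t+1}$ and noises $\omega_i^{t+1}\sim\mathcal N(0,\sigma_\omega^2I)$; for $i\notin\mathcal G$ the vector $c_i^{t+1}$ is arbitrary; for all $i$ put $m_i^{t+1}=m_i^t+\hat\beta c_i^{t+1}$. Here ${\rm clip}_\tau(x)=x$ if $\|x\|\le\tau$ and $\tau x/\|x\|$ otherwise. **Constants.** Let $\alpha\in(0,1)$, $\ell=\log\frac{16(T+1)G}{\alpha}$, $b=\sigma\sqrt{2\ell}$, $\hat c=\big(\sqrt2+2\sqrt{3\log\tfrac{8(T+1)}{\alpha}}\big)\sigma$,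 $b_1=\sqrt{3\log\tfrac{20(T+1)}{\alpha}}$, $\widetilde B=\max_{i\in\mathcal G}\|\nabla f_i(x^0)\|$, $B=\max\{3\tau,\widetilde B+b\}$, $\eta=\tau/B$, and let $\Delta>0$ satisfy $\Delta\ge\Phi^0$, where $$\Phi^0=f(x^0)-f^\star+\frac{8\gamma\beta}{\hat\beta^2\eta^2}\frac1G\sum_{i\in\mathcal G}\|v_i^0-\nabla f_i(x^0)\|^2+\frac{2\gamma}{\hat\beta\eta}\frac1G\sum_{i\in\mathcal G}\|g_i^0-v_i^0\|^2+\frac{2\gamma}{\beta}\Big\|\frac1G\sum_{i\in\mathcal G}v_i^0-\nabla f(x^0)\Big\|^2 .$$ **Corollary.** Let $\sigma_\omega=0$ and $\delta_{\rm byz}=0$. There are absolute constants $C>0$ and $k\in\mathbb N$ such that for all $L,\Delta,\sigma,\tau,\widetilde B,\alpha,G$ as above there is $T_0$, and for every $T\ge1$ there are hyperparameters $\beta\in(0,1]$, $\gamma=\beta/(12L)$ and $\hat\beta=1$, depending only on $L,\Delta,\sigma,\tau,\widetilde B,\alpha,G,T$, that satisfy the following (a bound with zero denominator is void): * $\gamma\le\frac1{24L}$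 and $\frac56-\frac{32L^2\beta^2\gamma^2}{\eta^2}-\frac{96L^2\gamma^2}{\eta^2}\ge0$; * $\beta\le\frac{8\tau}{431\sqrt{L\Delta}}$, $\beta\le\frac{2\tau}{39(B-\tau)}$, $\beta\le\frac{2\tau}{69b}$; * $\beta\le\big(\frac{L\Delta\eta}{12Tb^2}\big)^{1/3}$, $\beta\le\big(\frac{L\Delta\eta^2}{48Tb^2}\big)^{1/4}$, $\beta\le\big(\frac{L\Delta G}{12T\hat c^2}\big)^{1/2}$; * with $A=\sqrt2(1+b_1)\sigma\sqrt T$, $S_1=4\sqrt{L\Delta}+\frac32(B-\tau+b)$, $S_2=12\sqrt{L\Delta}+3(B-\tau+b)$: $\beta\le\big(\frac{3L\Delta\sqrt G\eta}{8AB}\big)^{1/2}$, $\beta\le\big(\frac{3L\Delta\eta\sqrt G}{16AS_1}\big)^{1/3}$, $\beta\le\big(\frac{9L\Delta\eta\sqrt G}{16AS_2}\big)^{1/4}$, $\beta\le\big(\frac{3L\Delta\eta^2\sqrt G}{64AS_1}\big)^{1/3}$, $\beta\le\frac{3L\Delta\sqrt G}{16AS_1}$, $\beta\le\big(\frac{9L\Delta\eta^2\sqrt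 G}{16AS_2}\big)^{1/4}$, $\beta\le\big(\frac{9L\Delta\sqrt G}{4AS_2}\big)^{1/2}$; and such that, for every problem with these constants and $\Phi^0\le\Delta$, each of the following bounds holds with probability at least $1-\alpha$: 1. $$\frac1T\sum_{t=0}^{T-1}\|\nabla f(x^t)\|^2\le C\ell^k\left(\frac{L\Delta(1+B/\tau)}{T}+\frac{\sigma(\sqrt{L\Delta}+B+\sigma)}{\sqrt{GT}}+h(T)\right),$$ where $h(T)=\frac{L\Delta}{T}\Big(\frac{\sqrt{L\Delta}}{\tau}+\big(\frac{T\sigma^2B^2}{L\Delta\tau^2}\big)^{1/4}+\big(\frac{T\sigma^2B}{L\Delta\tau}\big)^{1/3}\Big)$ collects the terms of higher order, $O(T^{-2/3})$ up to logarithms; 2. if $\sigma>0$ and $T\ge T_0$, the bound of 1. without $h(T)$; 3. if $\sigma>0$, $T\ge T_0$ and $\widetilde B>3\tau$, the bound of 1. without $h(T)$ and with $\widetilde B$ in place of $B$; 4. if $\sigma>0$ and $T\ge T_0$, the $\widetilde{\mathcal O}(1/\sqrt{GT})$ rate $\frac1T\sum_{t=0}^{T-1}\|\nabla f(x^t)\|^2\le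 C\ell^k\,\frac{\sigma(\sqrt{L\Delta}+B+\sigma)}{\sqrt{GT}}$. -/

import Mathlib

open MeasureTheory ProbabilityTheory
open scoped ENNReal

/-- The parameter space `ℝ^d` with the Euclidean norm. -/
abbrev RVec (d : ℕ) : Type := EuclideanSpace ℝ (Fin d)

noncomputable section

namespace ByzClip

/-! ### Problem class -/

/-- The global objective: the average of the local losses over the regular clients. -/
def globalLoss {d n : ℕ} (reg : Finset (Fin n)) (f : Fin n → RVec d → ℝ) (x : RVec d) : ℝ :=
  (1 / (reg.card : ℝ)) * ∑ i ∈ reg, f i x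

/-- The fraction of Byzantine clients among all `n` clients. -/
def byzFraction {n : ℕ} (reg : Finset (Fin n)) : ℝ := ((regᶜ).card : ℝ) / (n : ℝ)

/-- Every regular local loss is differentiable with `L`-Lipschitz gradient, and the global loss is
bounded below. -/
structure SmoothAssumption {d n : ℕ} (reg : Finset (Fin n)) (f : Fin n → RVec d → ℝ) (L : ℝ) :
    Prop where
  differentiable : ∀ i ∈ reg, Differentiable ℝ (f i)
  lipschitz_gradient : ∀ i ∈ reg, ∀ x y : RVec d,
    ‖gradient (f i) x - gradient (f i) y‖ ≤ L * ‖x - y‖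
  bddBelow : BddBelow (Set.range (globalLoss reg f))

/-- `sg i x s` is the stochastic gradient of client `i` at `x` for the sample `s`, where samples of
client `i` have law `D i`. It is unbiased, and its noise is `σ`-sub-Gaussian:
`E exp(‖θ‖² / σ²) ≤ e`; for `σ = 0` this is read as `θ = 0` almost surely. -/
structure StochGradAssumption {d n : ℕ} {Ξ : Type*} [MeasurableSpace Ξ] (reg : Finset (Fin n))
    (f : Fin n → RVec d → ℝ) (D : Fin n → Measure Ξ) (sg : Fin n → RVec d → Ξ → RVec d) (σ : ℝ) :
    Prop where
  measurable : ∀ i ∈ reg, Measurable (fun p : RVec d × Ξ => sg i p.1 p.2)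
  integrable : ∀ i ∈ reg, ∀ x, Integrable (sg i x) (D i)
  unbiased : ∀ i ∈ reg, ∀ x, ∫ s, sg i x s ∂(D i) = gradient (f i) x
  subGaussian : 0 < σ → ∀ i ∈ reg, ∀ x,
    ∫⁻ s, ENNReal.ofReal (Real.exp (‖sg i x s - gradient (f i) x‖ ^ 2 / σ ^ 2)) ∂(D i)
      ≤ ENNReal.ofReal (Real.exp 1)
  noiseless : σ = 0 → ∀ i ∈ reg, ∀ x, ∀ᵐ s ∂(D i), sg i x s = gradient (f i) x

/-- The randomness of a run of `T` iterations: at iteration `t + 1` (`t < T`) the regular client `i`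
draws a data sample with law `D i` and a privacy noise with law `N(0, σω² I)`, everything being
mutually independent. -/
structure RandomnessAssumption {d n : ℕ} {Ξ Ω : Type*} [MeasurableSpace Ξ] [MeasurableSpace Ω]
    (T : ℕ) (reg : Finset (Fin n)) (D : Fin n → Measure Ξ) (σω : ℝ) (μ : Measure Ω)
    (ξ : ℕ → Fin n → Ω → Ξ) (W : ℕ → Fin n → Ω → RVec d) : Prop where
  sample_law : ∀ t < T, ∀ i ∈ reg, HasLaw (ξ (t + 1) i) (D i) μ
  noise_law : ∀ t < T, ∀ i ∈ reg,
    HasLaw (W (t + 1) i)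
      (multivariateGaussian 0 (σω ^ 2 • (1 : Matrix (Fin d) (Fin d) ℝ))) μ
  indep_clients : iIndepFun
    (fun (p : Fin T × {i // i ∈ reg}) (ω : Ω) =>
      (ξ ((p.1 : ℕ) + 1) p.2 ω, W ((p.1 : ℕ) + 1) p.2 ω)) μ
  indep_noise : ∀ t < T, ∀ i ∈ reg, IndepFun (ξ (t + 1) i) (W (t + 1) i) μ

/-- `(δ, c)`-robust aggregation of `n` vectors with `nb` Byzantine clients, `δ = nb / n < 1/2`. -/
def IsRobustAggregator {d n : ℕ} (nb : ℕ) (c : ℝ) (RAgg : (Fin n → RVec d) → RVec d) : Prop :=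
  2 * nb < n ∧ 0 ≤ c ∧
    ∀ (x : Fin n → RVec d) (S : Finset (Fin n)), S.card = n - nb →
      ‖RAgg x - (1 / (S.card : ℝ)) • ∑ i ∈ S, x i‖ ^ 2
        ≤ c * ((nb : ℝ) / n) / (S.card : ℝ)
          * ∑ i ∈ S, ‖x i - (1 / (S.card : ℝ)) • ∑ j ∈ S, x j‖ ^ 2

/-! ### The algorithm Byz-Clip21-SGD2M -/

/-- Norm clipping at level `τ`. -/
def clip {d : ℕ} (τ : ℝ) (x : RVec d) : RVec d :=
  if ‖x‖ ≤ τ then x else (τ / ‖x‖) • x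

/-- The iterate `x`, the client buffers `v i` and `g i`, and the server buffers `m i`. -/
structure State (d n : ℕ) where
  x : RVec d
  v : Fin n → RVec d
  g : Fin n → RVec d
  m : Fin n → RVec d

/-- The start of a run: all buffers are zero. -/
def initState {d n : ℕ} (x₀ : RVec d) : State d n where
  x := x₀
  v := fun _ => 0
  g := fun _ => 0
  m := fun _ => 0

/-- One iteration. `sgt i` is the stochastic gradient map of client `i` for the sample of this
iteration, `w i` the privacy noise of the regular client `i`, and `byz i` the arbitrary vector sent
by the Byzantine client `i`. -/
def step {d n : ℕ} (reg : Finset (Fin n)) (RAgg : (Fin n → RVec d) → RVec d) (γ β βhat τ : ℝ)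
    (sgt : Fin n → RVec d → RVec d) (w byz : Fin n → RVec d) (s : State d n) : State d n :=
  let x' : RVec d := s.x - γ • RAgg s.m
  let v' : Fin n → RVec d := fun i =>
    if i ∈ reg then (1 - β) • s.v i + β • sgt i x' else s.v i
  let q : Fin n → RVec d := fun i => clip τ (v' i - s.g i)
  let c : Fin n → RVec d := fun i => if i ∈ reg then q i + w i else byz i
  { x := x'
    v := v'
    g := fun i => if i ∈ reg then s.g i + βhat • q i else s.g i
    m := fun i => s.m i + βhat • c i }

/-- The state after `t` iterations, as a function of the outcome `ω`. The messages
`byz (t + 1) i ω` of Byzantine clients are arbitrary. -/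
def run {d n : ℕ} {Ξ Ω : Type*} (reg : Finset (Fin n)) (RAgg : (Fin n → RVec d) → RVec d)
    (γ β βhat τ : ℝ) (sg : Fin n → RVec d → Ξ → RVec d) (x₀ : RVec d)
    (ξ : ℕ → Fin n → Ω → Ξ) (W byz : ℕ → Fin n → Ω → RVec d) (ω : Ω) : ℕ → State d n
  | 0 => initState x₀
  | t + 1 => step reg RAgg γ β βhat τ (fun i x => sg i x (ξ (t + 1) i ω))
      (fun i => W (t + 1) i ω) (fun i => byz (t + 1) i ω)
      (run reg RAgg γ β βhat τ sg x₀ ξ W byz ω t)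

/-- `(1/T) ∑_{t < T} ‖∇f(x^t)‖²` along a sequence of states. -/
def avgSqGrad {d n : ℕ} (reg : Finset (Fin n)) (f : Fin n → RVec d → ℝ) (T : ℕ)
    (s : ℕ → State d n) : ℝ :=
  (1 / (T : ℝ)) * ∑ t ∈ Finset.range T, ‖gradient (globalLoss reg f) (s t).x‖ ^ 2

/-- The Lyapunov function. -/
def lyapunov {d n : ℕ} (reg : Finset (Fin n)) (f : Fin n → RVec d → ℝ) (γ β βhat η : ℝ)
    (s : State d n) : ℝ :=
  globalLoss reg f s.x - (⨅ x, globalLoss reg f x)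
    + 8 * γ * β / (βhat ^ 2 * η ^ 2)
        * ((1 / (reg.card : ℝ)) * ∑ i ∈ reg, ‖s.v i - gradient (f i) s.x‖ ^ 2)
    + 2 * γ / (βhat * η) * ((1 / (reg.card : ℝ)) * ∑ i ∈ reg, ‖s.g i - s.v i‖ ^ 2)
    + 2 * γ / β
        * ‖(1 / (reg.card : ℝ)) • (∑ i ∈ reg, s.v i) - gradient (globalLoss reg f) s.x‖ ^ 2

/-! ### Constants and hyperparameter restrictions -/

/-- The logarithmic factor. -/
def logFactor (α : ℝ) (G T : ℕ) : ℝ := Real.log (16 * ((T : ℝ) + 1) * G / α)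

/-- High-probability bound on one stochastic gradient noise. -/
def bConst (σ α : ℝ) (G T : ℕ) : ℝ := σ * Real.sqrt (2 * logFactor α G T)

/-- `√G` times the high-probability bound on the averaged stochastic gradient noise. -/
def cHat (σ α : ℝ) (T : ℕ) : ℝ :=
  (Real.sqrt 2 + 2 * Real.sqrt (3 * Real.log (8 * ((T : ℝ) + 1) / α))) * σ

/-- The constant in the concentration of the martingale terms. -/
def bOne (α : ℝ) (T : ℕ) : ℝ := Real.sqrt (3 * Real.log (20 * ((T : ℝ) + 1) / α))

/-- `max {3τ, max_i ‖∇f_i(x⁰)‖ + b}`, where `M` stands for `max_i ‖∇f_i(x⁰)‖`. -/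
def bInit (σ τ M α : ℝ) (G T : ℕ) : ℝ := max (3 * τ) (M + bConst σ α G T)

/-- The contraction factor of clipping. -/
def etaConst (σ τ M α : ℝ) (G T : ℕ) : ℝ := τ / bInit σ τ M α G T

/-- The restrictions on the step size `γ` and the momentum `β` when the server momentum is `1`,
there is no privacy noise and there are no Byzantine clients. An upper bound of the form
`β ≤ (A / D) ^ (1 / p)` is written as `β ^ p * D ≤ A`, so that it is void when `D = 0`. -/
structure HyperRestrictions (L Δ σ τ M α : ℝ) (G T : ℕ) (γ β : ℝ) : Prop where
  gamma_pos : 0 < γ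
  beta_pos : 0 < β
  beta_le_one : β ≤ 1
  gamma_le : γ ≤ 1 / (24 * L)
  beta_eq : 12 * L * γ = β
  stepsize : 0 ≤ 5 / 6
    - 32 * L ^ 2 * β ^ 2 / etaConst σ τ M α G T ^ 2 * γ ^ 2
    - 96 * L ^ 2 / etaConst σ τ M α G T ^ 2 * γ ^ 2
  mom_a : β * (431 * Real.sqrt (L * Δ)) ≤ 8 * τ
  mom_b : β * (39 * (bInit σ τ M α G T - τ)) ≤ 2 * τ
  mom_c : β * (69 * bConst σ α G T) ≤ 2 * τ
  mom_one₁ : β ^ 3 * (12 * T * bConst σ α G T ^ 2) ≤ L * Δ * etaConst σ τ M α G T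
  mom_one₂ : β ^ 4 * (48 * T * bConst σ α G T ^ 2) ≤ L * Δ * etaConst σ τ M α G T ^ 2
  mom_one₃ : β ^ 2 * (12 * T * cHat σ α T ^ 2) ≤ L * Δ * G
  mom_two : β ^ 2 * (8 * Real.sqrt 2 * (1 + bOne α T) * bInit σ τ M α G T * σ * Real.sqrt T)
    ≤ 3 * L * Δ * Real.sqrt G * etaConst σ τ M α G T
  mom_three : β ^ 3 * (16 * Real.sqrt 2 * (1 + bOne α T) * σ * Real.sqrt T
      * (4 * Real.sqrt (L * Δ) + 3 / 2 * (bInit σ τ M α G T - τ) + 3 / 2 * bConst σ α G T))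
    ≤ 3 * L * Δ * etaConst σ τ M α G T * Real.sqrt G
  mom_four : β ^ 4 * (16 * Real.sqrt 2 * (1 + bOne α T) * σ * Real.sqrt T
      * (12 * Real.sqrt (L * Δ) + 3 * (bInit σ τ M α G T - τ + bConst σ α G T)))
    ≤ 9 * L * Δ * etaConst σ τ M α G T * Real.sqrt G
  mom_five : β ^ 3 * (64 * Real.sqrt 2 * (1 + bOne α T) * σ * Real.sqrt T
      * (4 * Real.sqrt (L * Δ) + 3 / 2 * (bInit σ τ M α G T - τ + bConst σ α G T)))
    ≤ 3 * L * Δ * etaConst σ τ M α G T ^ 2 * Real.sqrt G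
  mom_six : β * (16 * Real.sqrt 2 * (1 + bOne α T) * σ * Real.sqrt T
      * (4 * Real.sqrt (L * Δ) + 3 / 2 * (bInit σ τ M α G T - τ + bConst σ α G T)))
    ≤ 3 * L * Δ * Real.sqrt G
  mom_seven : β ^ 4 * (16 * Real.sqrt 2 * (1 + bOne α T) * σ * Real.sqrt T
      * (12 * Real.sqrt (L * Δ) + 3 * (bInit σ τ M α G T - τ + bConst σ α G T)))
    ≤ 9 * L * Δ * etaConst σ τ M α G T ^ 2 * Real.sqrt G
  mom_eight : β ^ 2 * (4 * Real.sqrt 2 * (1 + bOne α T) * σ * Real.sqrt T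
      * (12 * Real.sqrt (L * Δ) + 3 * (bInit σ τ M α G T - τ + bConst σ α G T)))
    ≤ 9 * L * Δ * Real.sqrt G

/-! ### The rate -/

/-- The `1/√(GT)` term of the rate. -/
def leadingRate (L Δ σ B : ℝ) (G T : ℕ) : ℝ :=
  σ * (Real.sqrt (L * Δ) + B + σ) / Real.sqrt ((G : ℝ) * T)

/-- The rate `LΔ(1 + B/τ)/T + σ(√(LΔ) + B + σ)/√(GT)`. -/
def mainRate (L Δ σ τ B : ℝ) (G T : ℕ) : ℝ :=
  L * Δ * (1 + B / τ) / T + leadingRate L Δ σ B G T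

/-- The terms of higher order in `1/T` (orders `1/T`, `T^(-3/4)` and `T^(-2/3)`) that the notation
`Õ` hides. They come from the restrictions `mom_a`, `mom_one₂` and `mom_one₁`. -/
def hiddenTerms (L Δ σ τ B : ℝ) (T : ℕ) : ℝ :=
  L * Δ / T *
    (Real.sqrt (L * Δ) / τ
      + ((T : ℝ) * σ ^ 2 * B ^ 2 / (L * Δ * τ ^ 2)) ^ (1 / 4 : ℝ)
      + ((T : ℝ) * σ ^ 2 * B / (L * Δ * τ)) ^ (1 / 3 : ℝ))

end ByzClip

end

-- With no Byzantine clients, robustness forces the aggregator to be the exact average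
-- (`IsRobustAggregator.eq_average`). With server momentum `1` and no privacy noise, an inactive
-- clipping operator gives `g = m = v`, so the method is plain SGD with momentum. The restrictions
-- make `β` so small that, with high probability, clipping is never active. It therefore suffices to
-- study the unclipped process `momentumRun` and to transfer the result on a good event
-- (`run_eq_momentumRun`). The unclipped process is defined for every outcome, so no stopping time
-- is needed.
--
-- For momentum SGD take `Φ = f - inf f + (γ/β) ‖v̄ - ∇f‖²`, with `v̄` the average momentum. With
-- `12 L γ = β` one step lowers `Φ` by `(γ/2) ‖∇f(x)‖² + (γ/8) ‖a‖²`, up to a linear and a quadratic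
-- term in the averaged noise, where `a = v̄ - ∇f(x')` is known before the new sample is drawn
-- (`momentum_lyapunov_step`). The averaged noise has a dimension-free exponential moment of proxy
-- of order `κ/n` (`lintegral_exp_sum_le_of_normSubGaussian`). The gain `(γ/8) ‖a‖²` pays for the
-- linear term, so `exp(λ (Φ_t + (γ/2) ∑_{s<t} ‖∇f(x^s)‖² - t c))` has nonincreasing expectation for
-- `λ = n/(128 γ κ)` and `c = 2 γ β κ / n` (`lintegral_exp_momentumLyapunov_le`).
--
-- Markov's inequality and union bounds give, with probability at least `1 - α`, that this Lyapunov
-- sum stays below `2Δ` and every client noise is at most `b` (`measure_not_controlled_le`). On that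
-- event client momenta move by at most `τ` per step (`norm_momentum_increment_le`), so clipping is
-- inactive, and the average squared gradient is at most `4Δ/(γT)`.
--
-- Finally `1/β` is chosen as `1000 ℓ` times the claimed rate, rescaled by `T/(LΔ)`. Each summand of
-- the rate then secures certain restrictions (`hyperRestrictions_inverseMomentum`), and `4Δ/(γT)`
-- becomes `48000 ℓ` times the rate. For large `T` everything except the `1/√(GT)` term is
-- negligible (`exists_horizon`).

-- Smooth functions and the deterministic momentum step.

section Smooth

variable {E : Type*} [NormedAddCommGroup E] [InnerProductSpace ℝ E] [CompleteSpace E]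

/-- The descent inequality for a function with Lipschitz gradient. -/
theorem le_quadratic_of_lipschitz_gradient {f : E → ℝ} {L : ℝ} (hf : Differentiable ℝ f)
    (hL : ∀ x y, ‖gradient f x - gradient f y‖ ≤ L * ‖x - y‖) (x d : E) :
    f (x + d) ≤ f x + inner ℝ (gradient f x) d + L / 2 * ‖d‖ ^ 2 := by
  have hder : ∀ t : ℝ, HasDerivAt
      (fun t : ℝ => f (x + t • d) - t * inner ℝ (gradient f x) d - L / 2 * ‖d‖ ^ 2 * t ^ 2)
      (inner ℝ (gradient f (x + t • d)) d - 1 * inner ℝ (gradient f x) d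
        - L / 2 * ‖d‖ ^ 2 * (2 * t)) t := by
    intro t
    have h1 : HasDerivAt (fun t : ℝ => x + t • d) d t := by
      simpa using ((hasDerivAt_id t).smul_const d).const_add x
    have h2 := (hf (x + t • d)).hasGradientAt.hasFDerivAt.comp_hasDerivAt t h1
    have h3 : HasDerivAt (fun t : ℝ => t ^ 2) (2 * t) t := by simpa using hasDerivAt_pow 2 t
    exact (h2.sub ((hasDerivAt_id t).mul_const _)).sub (h3.const_mul _)
  -- The gap to the quadratic model along the segment is nonincreasing in `t`; comparing `t = 0` and
  -- `t = 1` avoids integrating the gradient.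
  have hanti := antitoneOn_of_deriv_nonpos (convex_Icc (0 : ℝ) 1)
    (fun t _ => (hder t).continuousAt.continuousWithinAt)
    (fun t _ => (hder t).differentiableAt.differentiableWithinAt) (by
      intro t ht
      rw [interior_Icc] at ht
      rw [(hder t).deriv, one_mul, ← inner_sub_left]
      have h1 := real_inner_le_norm (gradient f (x + t • d) - gradient f x) d
      have h2 := hL (x + t • d) x
      rw [add_sub_cancel_left, norm_smul, Real.norm_of_nonneg ht.1.le] at h2
      nlinarith [mul_le_mul_of_nonneg_right h2 (norm_nonneg d)])
  have := hanti (Set.left_mem_Icc.2 zero_le_one) (Set.right_mem_Icc.2 zero_le_one) zero_le_one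
  simp only [one_smul, zero_smul, add_zero, one_mul, zero_mul, one_pow, mul_one, sub_zero, ne_eq,
    OfNat.ofNat_ne_zero, not_false_eq_true, zero_pow, mul_zero] at this
  linarith

/-- The gradient is controlled by the gap to a lower bound. -/
theorem sq_norm_gradient_le {f : E → ℝ} {L m : ℝ} (hL0 : 0 < L) (hf : Differentiable ℝ f)
    (hL : ∀ x y, ‖gradient f x - gradient f y‖ ≤ L * ‖x - y‖) (hm : ∀ x, m ≤ f x) (x : E) :
    ‖gradient f x‖ ^ 2 ≤ 2 * L * (f x - m) := by
  -- A gradient step of length `1/L` lowers `f` by at least `‖∇f‖²/(2L)`, yet not below `m`.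
  have h := le_quadratic_of_lipschitz_gradient hf hL x (-(1 / L) • gradient f x)
  have h2 := hm (x + -(1 / L) • gradient f x)
  rw [real_inner_smul_right, real_inner_self_eq_norm_sq, norm_smul, norm_neg,
    Real.norm_of_nonneg (by positivity), mul_pow] at h
  have h3 : -(1 / L) * ‖gradient f x‖ ^ 2 + L / 2 * ((1 / L) ^ 2 * ‖gradient f x‖ ^ 2)
      = - (‖gradient f x‖ ^ 2 / (2 * L)) := by field_simp; ring
  have h4 : ‖gradient f x‖ ^ 2 / (2 * L) ≤ f x - m := by linarith
  rwa [div_le_iff₀ (by positivity), mul_comm] at h4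

/-- One step of stochastic gradient descent with momentum, before taking expectations: the
Lyapunov function `f - m + (γ/β) ‖v - ∇f‖²` decreases up to noise terms. -/
theorem momentum_lyapunov_step {f : E → ℝ} {L γ β : ℝ} (hL0 : 0 < L) (hf : Differentiable ℝ f)
    (hL : ∀ x y, ‖gradient f x - gradient f y‖ ≤ L * ‖x - y‖) (hβ : 0 < β) (hβ1 : β ≤ 1)
    (hγ : 12 * L * γ = β) (x v θ : E) :
    let x' := x - γ • v
    let a := v - gradient f x'
    f x' + γ / β * ‖(1 - β) • v + β • (gradient f x' + θ) - gradient f x'‖ ^ 2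
        + γ / 2 * ‖gradient f x‖ ^ 2 + γ / 8 * ‖a‖ ^ 2
      ≤ f x + γ / β * ‖v - gradient f x‖ ^ 2
        + (2 * γ * (1 - β) * inner ℝ a θ + γ * β * ‖θ‖ ^ 2) := by
  intro x' a
  have hγ0 : 0 < γ := by nlinarith
  set u := v - gradient f x with hu
  set δ := gradient f x - gradient f x' with hδ
  have hd := le_quadratic_of_lipschitz_gradient hf hL x (-(γ • v))
  rw [← sub_eq_add_neg] at hd
  change f x' ≤ _ at hd
  rw [inner_neg_right, real_inner_smul_right, norm_neg, norm_smul,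
    Real.norm_of_nonneg hγ0.le] at hd
  -- Polarization turns the descent term `-γ⟨∇f, v⟩` into `-γ/2 ‖∇f‖² - γ/2 ‖v‖² + γ/2 ‖u‖²`; the
  -- negative `‖v‖²` absorbs all later errors.
  have hpol : ‖u‖ ^ 2 = ‖v‖ ^ 2 - 2 * inner ℝ (gradient f x) v + ‖gradient f x‖ ^ 2 := by
    rw [hu, norm_sub_sq_real, real_inner_comm]
  have hδn : ‖δ‖ ≤ β / 12 * ‖v‖ := by
    have := hL x x'
    have hx : x - x' = γ • v := by simp [x']
    rw [hx, norm_smul, Real.norm_of_nonneg hγ0.le] at this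
    calc ‖δ‖ ≤ L * (γ * ‖v‖) := this
      _ = β / 12 * ‖v‖ := by rw [← hγ]; ring
  have ha : a = u + δ := by simp only [a, hu, hδ]; abel
  have hnew : (1 - β) • v + β • (gradient f x' + θ) - gradient f x' = (1 - β) • a + β • θ := by
    simp only [a]; module
  rw [hnew]
  have hexp : ‖(1 - β) • a + β • θ‖ ^ 2
      = (1 - β) ^ 2 * ‖a‖ ^ 2 + 2 * (β * (1 - β)) * inner ℝ a θ + β ^ 2 * ‖θ‖ ^ 2 := by
    rw [norm_add_sq_real, norm_smul, norm_smul, real_inner_smul_left, real_inner_smul_right,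
      mul_pow, mul_pow, Real.norm_eq_abs, Real.norm_eq_abs, sq_abs, sq_abs]
    ring
  have haexp : ‖a‖ ^ 2 = ‖u‖ ^ 2 + 2 * inner ℝ u δ + ‖δ‖ ^ 2 := by
    rw [ha, norm_add_sq_real]
  have hin := real_inner_le_norm u δ
  have hδ2 : ‖δ‖ ^ 2 ≤ β ^ 2 / 144 * ‖v‖ ^ 2 := by
    calc ‖δ‖ ^ 2 ≤ (β / 12 * ‖v‖) ^ 2 := by gcongr
      _ = _ := by ring
  -- Young's inequality, used with `s = β` to keep a contraction factor `1 - β`, and with `s = 1` to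
  -- pay for the extra `γ/8 ‖a‖²`.
  have hamul : ∀ s : ℝ, 0 < s → ‖a‖ ^ 2 ≤ (1 + s) * ‖u‖ ^ 2 + (1 + 1 / s) * ‖δ‖ ^ 2 := by
    intro s hs
    have : 2 * (‖u‖ * ‖δ‖) ≤ s * ‖u‖ ^ 2 + 1 / s * ‖δ‖ ^ 2 := by
      have h0 : 0 ≤ (s * ‖u‖ - ‖δ‖) ^ 2 / s := by positivity
      have h1 : (s * ‖u‖ - ‖δ‖) ^ 2 / s
          = s * ‖u‖ ^ 2 + 1 / s * ‖δ‖ ^ 2 - 2 * (‖u‖ * ‖δ‖) := by field_simp; ring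
      linarith
    linarith
  have h1 : (1 - β) ^ 2 * ‖a‖ ^ 2 ≤ (1 - β) * ‖u‖ ^ 2 + β / 144 * ‖v‖ ^ 2 := by
    have hA := mul_le_mul_of_nonneg_left (hamul β hβ) (sq_nonneg (1 - β))
    have hB : (1 - β) ^ 2 * (1 + β) ≤ 1 - β := by nlinarith [mul_nonneg hβ.le (sub_nonneg.2 hβ1)]
    have hC : (1 - β) ^ 2 * (1 + 1 / β) * ‖δ‖ ^ 2 ≤ β / 144 * ‖v‖ ^ 2 := by
      have hC1 : (1 - β) ^ 2 * (1 + 1 / β) ≤ 1 / β := by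
        have : (1 - β) ^ 2 * (1 + 1 / β) = (1 - β) ^ 2 * (1 + β) * (1 / β) := by field_simp; ring
        rw [this]
        have : 0 < 1 / β := by positivity
        nlinarith
      calc (1 - β) ^ 2 * (1 + 1 / β) * ‖δ‖ ^ 2 ≤ 1 / β * (β ^ 2 / 144 * ‖v‖ ^ 2) := by
            gcongr
        _ = _ := by field_simp
    nlinarith [mul_le_mul_of_nonneg_right hB (sq_nonneg ‖u‖)]
  have h2 : ‖a‖ ^ 2 ≤ 2 * ‖u‖ ^ 2 + 1 / 72 * ‖v‖ ^ 2 := by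
    have := hamul 1 one_pos
    have hb2 : β ^ 2 ≤ 1 := by nlinarith
    nlinarith [mul_le_mul_of_nonneg_right hb2 (sq_nonneg ‖v‖)]
  have h3 : γ / β * ((1 - β) ^ 2 * ‖a‖ ^ 2)
      ≤ γ / β * ‖u‖ ^ 2 - γ * ‖u‖ ^ 2 + γ / 144 * ‖v‖ ^ 2 := by
    have h0 := mul_le_mul_of_nonneg_left h1 (div_pos hγ0 hβ).le
    have h00 : γ / β * ((1 - β) * ‖u‖ ^ 2 + β / 144 * ‖v‖ ^ 2)
        = γ / β * ‖u‖ ^ 2 - γ * ‖u‖ ^ 2 + γ / 144 * ‖v‖ ^ 2 := by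
      generalize ‖u‖ = p
      generalize ‖v‖ = q
      field_simp
    linarith
  have h4 : γ / β * ‖(1 - β) • a + β • θ‖ ^ 2
      = γ / β * ((1 - β) ^ 2 * ‖a‖ ^ 2) + 2 * γ * (1 - β) * inner ℝ a θ + γ * β * ‖θ‖ ^ 2 := by
    rw [hexp]
    generalize ‖a‖ = p
    generalize inner ℝ a θ = q
    generalize ‖θ‖ = r
    field_simp
  have h5 : L / 2 * (γ * ‖v‖) ^ 2 ≤ γ / 24 * ‖v‖ ^ 2 := by
    have : L / 2 * (γ * ‖v‖) ^ 2 = (12 * L * γ) * γ / 24 * ‖v‖ ^ 2 := by ring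
    rw [this, hγ]
    have h0 : 0 ≤ γ / 24 * ‖v‖ ^ 2 := by positivity
    calc β * γ / 24 * ‖v‖ ^ 2 = β * (γ / 24 * ‖v‖ ^ 2) := by ring
      _ ≤ _ := mul_le_of_le_one_left h0 hβ1
  have h6 := mul_le_mul_of_nonneg_left h2 hγ0.le
  have h7 : γ / 2 * ‖u‖ ^ 2
      = γ / 2 * (‖v‖ ^ 2 - 2 * inner ℝ (gradient f x) v + ‖gradient f x‖ ^ 2) := by rw [hpol]
  have h8 : 0 ≤ γ * ‖v‖ ^ 2 := by positivity
  have h9 : 0 ≤ γ * ‖u‖ ^ 2 := by positivity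
  rw [h4]
  clear_value a u δ x'
  clear hamul hexp hnew haexp hin hδ2 hδn hpol h1 h2 h4 hL
  linarith

end Smooth

-- Smoothness of the averaged loss.

namespace ByzClip

variable {d n : ℕ} {reg : Finset (Fin n)} {f : Fin n → RVec d → ℝ} {L : ℝ}

theorem SmoothAssumption.hasGradientAt_globalLoss (h : SmoothAssumption reg f L) (x : RVec d) :
    HasGradientAt (globalLoss reg f) ((1 / (reg.card : ℝ)) • ∑ i ∈ reg, gradient (f i) x) x := by
  rw [hasGradientAt_iff_hasFDerivAt, map_smul, map_sum]
  have := HasFDerivAt.fun_sum (u := reg) fun i hi =>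
    (h.differentiable i hi x).hasGradientAt.hasFDerivAt
  exact this.const_mul (1 / (reg.card : ℝ))

theorem SmoothAssumption.gradient_globalLoss (h : SmoothAssumption reg f L) (x : RVec d) :
    gradient (globalLoss reg f) x = (1 / (reg.card : ℝ)) • ∑ i ∈ reg, gradient (f i) x :=
  (h.hasGradientAt_globalLoss x).gradient

theorem SmoothAssumption.differentiable_globalLoss (h : SmoothAssumption reg f L) :
    Differentiable ℝ (globalLoss reg f) :=
  fun x => (h.hasGradientAt_globalLoss x).differentiableAt

/-- The norm of an average is at most a common bound of the norms. -/
theorem norm_average_le {reg : Finset (Fin n)} (hreg : 0 < reg.card) {y : Fin n → RVec d} {r : ℝ}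
    (hy : ∀ i ∈ reg, ‖y i‖ ≤ r) : ‖(1 / (reg.card : ℝ)) • ∑ i ∈ reg, y i‖ ≤ r := by
  have hc : (0 : ℝ) < reg.card := by exact_mod_cast hreg
  rw [norm_smul, Real.norm_of_nonneg (by positivity), one_div, inv_mul_le_iff₀ hc]
  calc ‖∑ i ∈ reg, y i‖ ≤ ∑ i ∈ reg, r := norm_sum_le_of_le _ hy
    _ = reg.card * r := by simp

theorem SmoothAssumption.lipschitz_globalLoss (h : SmoothAssumption reg f L) (hreg : 0 < reg.card)
    (x y : RVec d) :
    ‖gradient (globalLoss reg f) x - gradient (globalLoss reg f) y‖ ≤ L * ‖x - y‖ := by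
  rw [h.gradient_globalLoss, h.gradient_globalLoss, ← smul_sub, ← Finset.sum_sub_distrib]
  exact norm_average_le hreg fun i hi => h.lipschitz_gradient i hi x y

end ByzClip

-- Exponential moments of norm-sub-Gaussian vectors.

section SubGaussian

variable {Ω E : Type*} [MeasurableSpace Ω] {μ : Measure Ω}
  [NormedAddCommGroup E]

/-- The vector `X` is norm-sub-Gaussian with variance proxy `κ`: `E exp(‖X‖² / κ) ≤ e`. -/
def NormSubGaussian (X : Ω → E) (κ : ℝ) (μ : Measure Ω) : Prop :=
  ∫⁻ ω, ENNReal.ofReal (Real.exp (‖X ω‖ ^ 2 / κ)) ∂μ ≤ ENNReal.ofReal (Real.exp 1)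

/-- The linear term vanishes in expectation for a centred variable, leaving only a squared
exponential, which the sub-Gaussian hypothesis controls. -/
theorem Real.exp_le_add_exp_sq (x : ℝ) : Real.exp x ≤ x + Real.exp (x ^ 2) := by
  have h1 := Real.add_one_le_exp (x ^ 2)
  rcases le_or_gt |x| 1 with h | h
  · have := (abs_le.1 (Real.abs_exp_sub_one_sub_id_le h)).2
    linarith
  · rcases lt_abs.1 h with h | h
    · have : Real.exp x ≤ Real.exp (x ^ 2) := Real.exp_le_exp.2 (by nlinarith)
      linarith
    · have : Real.exp x ≤ 1 := Real.exp_le_one_iff.2 (by linarith)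
      nlinarith

theorem normSubGaussian_of_ae_eq_zero [IsProbabilityMeasure μ] {X : Ω → E} (h : X =ᵐ[μ] 0) (κ : ℝ) :
    NormSubGaussian X κ μ := by
  have : ∫⁻ ω, ENNReal.ofReal (Real.exp (‖X ω‖ ^ 2 / κ)) ∂μ = ∫⁻ _, 1 ∂μ := by
    refine lintegral_congr_ae ?_
    filter_upwards [h] with ω hω
    simp [hω]
  rw [NormSubGaussian, this, lintegral_one, measure_univ]
  simp

variable [MeasurableSpace E] [BorelSpace E]

/-- A norm-sub-Gaussian vector is large with small probability only. -/
theorem NormSubGaussian.measure_lt_norm_sq_le {X : Ω → E} {κ : ℝ}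
    (h : NormSubGaussian X κ μ) (hκ : 0 < κ) (hX : Measurable X) (r : ℝ) :
    μ {ω | r * κ < ‖X ω‖ ^ 2} ≤ ENNReal.ofReal (Real.exp (1 - r)) := by
  have hmk := mul_meas_ge_le_lintegral (μ := μ)
    (f := fun ω => ENNReal.ofReal (Real.exp (‖X ω‖ ^ 2 / κ))) (by fun_prop)
    (ENNReal.ofReal (Real.exp r))
  have hsub : {ω | r * κ < ‖X ω‖ ^ 2}
      ⊆ {ω | ENNReal.ofReal (Real.exp r) ≤ ENNReal.ofReal (Real.exp (‖X ω‖ ^ 2 / κ))} := by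
    intro ω hω
    refine ENNReal.ofReal_le_ofReal (Real.exp_le_exp.2 ?_)
    rw [le_div_iff₀ hκ]
    exact le_of_lt hω
  have h1 := (mul_le_mul_right (measure_mono hsub) _).trans (hmk.trans h)
  rw [sub_eq_neg_add, Real.exp_add, Real.exp_neg, ENNReal.ofReal_mul (by positivity),
    ENNReal.ofReal_inv_of_pos (Real.exp_pos _), ← ENNReal.div_eq_inv_mul,
    ENNReal.le_div_iff_mul_le (.inl (by simp [Real.exp_pos])) (.inl ENNReal.ofReal_ne_top), mul_comm]
  exact h1

variable [IsProbabilityMeasure μ]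

/-- Jensen's inequality for the power `p κ ≤ 1`, realised by the chord bound `exp(r z) ≤ r exp z + 1
- r` at `z = ‖X‖²/κ - 1`. -/
theorem NormSubGaussian.lintegral_exp_mul_sq_le {X : Ω → E} {κ p : ℝ}
    (h : NormSubGaussian X κ μ) (hκ : 0 < κ) (hX : Measurable X) (hp : 0 ≤ p) (hpκ : p * κ ≤ 1) :
    ∫⁻ ω, ENNReal.ofReal (Real.exp (p * ‖X ω‖ ^ 2)) ∂μ ≤ ENNReal.ofReal (Real.exp (p * κ)) := by
  set r := p * κ with hr
  have hr0 : 0 ≤ r := by positivity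
  have key : ∀ ω, ENNReal.ofReal (Real.exp (p * ‖X ω‖ ^ 2))
      ≤ ENNReal.ofReal (Real.exp r * (1 - r))
        + ENNReal.ofReal (Real.exp r * r * Real.exp (-1))
          * ENNReal.ofReal (Real.exp (‖X ω‖ ^ 2 / κ)) := by
    intro ω
    rw [← ENNReal.ofReal_mul (by positivity), ← ENNReal.ofReal_add
      (mul_nonneg (Real.exp_pos _).le (by linarith)) (by positivity)]
    refine ENNReal.ofReal_le_ofReal ?_
    have hc := convexOn_exp.2 (Set.mem_univ (‖X ω‖ ^ 2 / κ - 1)) (Set.mem_univ 0) hr0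
      (sub_nonneg.2 hpκ) (by ring)
    simp only [smul_eq_mul, mul_zero, add_zero, Real.exp_zero, mul_one] at hc
    have he : p * ‖X ω‖ ^ 2 = r + r * (‖X ω‖ ^ 2 / κ - 1) := by rw [hr]; field_simp; ring
    rw [he, Real.exp_add]
    have h2 : Real.exp r * r * Real.exp (-1) * Real.exp (‖X ω‖ ^ 2 / κ)
        = Real.exp r * (r * Real.exp (‖X ω‖ ^ 2 / κ - 1)) := by
      rw [sub_eq_add_neg, Real.exp_add]; ring
    rw [h2, ← mul_add]
    gcongr
    linarith
  have hm : Measurable fun ω => ENNReal.ofReal (Real.exp (‖X ω‖ ^ 2 / κ)) := by fun_prop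
  calc _ ≤ ∫⁻ ω, (ENNReal.ofReal (Real.exp r * (1 - r))
        + ENNReal.ofReal (Real.exp r * r * Real.exp (-1))
          * ENNReal.ofReal (Real.exp (‖X ω‖ ^ 2 / κ))) ∂μ := lintegral_mono key
    _ = ENNReal.ofReal (Real.exp r * (1 - r))
        + ENNReal.ofReal (Real.exp r * r * Real.exp (-1))
          * ∫⁻ ω, ENNReal.ofReal (Real.exp (‖X ω‖ ^ 2 / κ)) ∂μ := by
      rw [lintegral_add_left measurable_const, lintegral_const_mul _ hm]; simp
    _ ≤ ENNReal.ofReal (Real.exp r * (1 - r))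
        + ENNReal.ofReal (Real.exp r * r * Real.exp (-1)) * ENNReal.ofReal (Real.exp 1) := by
      gcongr; exact h
    _ = ENNReal.ofReal (Real.exp r) := by
      rw [← ENNReal.ofReal_mul (by positivity), ← ENNReal.ofReal_add
        (mul_nonneg (Real.exp_pos _).le (by linarith)) (by positivity)]
      congr 1
      rw [mul_assoc _ (Real.exp (-1)), ← Real.exp_add]
      simp; ring

variable [InnerProductSpace ℝ E] [SecondCountableTopology E]

/-- For small `‖a‖² κ`, centring and `Real.exp_le_add_exp_sq` suffice. For large `‖a‖² κ` the mean
is irrelevant: Young's inequality gives `⟨a, X⟩ ≤ ‖a‖² κ/2 + ‖X‖²/(2κ)`, and the resulting factor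
`exp(1/2)` is at most `exp(‖a‖² κ/2)`. -/
theorem NormSubGaussian.lintegral_exp_inner_le {X : Ω → E} {κ : ℝ}
    (h : NormSubGaussian X κ μ) (hκ : 0 < κ) (hX : Measurable X) (hi : Integrable X μ)
    (h0 : ∫ ω, X ω ∂μ = 0) [CompleteSpace E] (a : E) :
    ∫⁻ ω, ENNReal.ofReal (Real.exp (inner ℝ a (X ω))) ∂μ
      ≤ ENNReal.ofReal (Real.exp (‖a‖ ^ 2 * κ)) := by
  have hsq : ∀ ω, (inner ℝ a (X ω)) ^ 2 ≤ ‖a‖ ^ 2 * ‖X ω‖ ^ 2 := fun ω => by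
    rw [← sq_abs, ← mul_pow]
    gcongr
    exact abs_real_inner_le_norm _ _
  rcases le_or_gt (‖a‖ ^ 2 * κ) 1 with ha | ha
  · have hb := h.lintegral_exp_mul_sq_le hκ hX (sq_nonneg ‖a‖) ha
    have hint : Integrable (fun ω => Real.exp (‖a‖ ^ 2 * ‖X ω‖ ^ 2)) μ := by
      refine ⟨by fun_prop, ?_⟩
      rw [hasFiniteIntegral_iff_ofReal (.of_forall fun _ => (Real.exp_pos _).le)]
      exact hb.trans_lt ENNReal.ofReal_lt_top
    have hint2 : Integrable (fun ω => inner ℝ a (X ω)) μ := hi.const_inner a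
    calc _ ≤ ∫⁻ ω, ENNReal.ofReal (inner ℝ a (X ω) + Real.exp (‖a‖ ^ 2 * ‖X ω‖ ^ 2)) ∂μ := by
          refine lintegral_mono fun ω => ENNReal.ofReal_le_ofReal ?_
          refine (Real.exp_le_add_exp_sq _).trans ?_
          gcongr
          exact hsq ω
      _ = ENNReal.ofReal (∫ ω, (inner ℝ a (X ω) + Real.exp (‖a‖ ^ 2 * ‖X ω‖ ^ 2)) ∂μ) := by
          refine (ofReal_integral_eq_lintegral_ofReal (hint2.add hint)
            (.of_forall fun ω => ?_)).symm
          refine (Real.exp_pos _).le.trans ((Real.exp_le_add_exp_sq (inner ℝ a (X ω))).trans ?_)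
          simp only [Pi.add_apply]
          gcongr
          exact hsq ω
      _ = ENNReal.ofReal (∫ ω, Real.exp (‖a‖ ^ 2 * ‖X ω‖ ^ 2) ∂μ) := by
          rw [integral_add hint2 hint, integral_inner hi, h0, inner_zero_right, zero_add]
      _ = ∫⁻ ω, ENNReal.ofReal (Real.exp (‖a‖ ^ 2 * ‖X ω‖ ^ 2)) ∂μ :=
          ofReal_integral_eq_lintegral_ofReal hint (.of_forall fun _ => (Real.exp_pos _).le)
      _ ≤ _ := hb
  · have hb := h.lintegral_exp_mul_sq_le hκ hX (p := 1 / (2 * κ)) (by positivity)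
      (by field_simp; norm_num)
    calc _ ≤ ∫⁻ ω, ENNReal.ofReal (Real.exp (‖a‖ ^ 2 * κ / 2))
            * ENNReal.ofReal (Real.exp (1 / (2 * κ) * ‖X ω‖ ^ 2)) ∂μ := by
          refine lintegral_mono fun ω => ?_
          rw [← ENNReal.ofReal_mul (Real.exp_pos _).le, ← Real.exp_add]
          refine ENNReal.ofReal_le_ofReal (Real.exp_le_exp.2 ?_)
          have h1 := real_inner_le_norm a (X ω)
          have h2 : 0 ≤ (‖a‖ * κ - ‖X ω‖) ^ 2 / (2 * κ) := by positivity
          have h3 : (‖a‖ * κ - ‖X ω‖) ^ 2 / (2 * κ)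
              = ‖a‖ ^ 2 * κ / 2 + 1 / (2 * κ) * ‖X ω‖ ^ 2 - ‖a‖ * ‖X ω‖ := by
            field_simp; ring
          linarith
      _ = ENNReal.ofReal (Real.exp (‖a‖ ^ 2 * κ / 2))
            * ∫⁻ ω, ENNReal.ofReal (Real.exp (1 / (2 * κ) * ‖X ω‖ ^ 2)) ∂μ :=
          lintegral_const_mul _ (by fun_prop)
      _ ≤ ENNReal.ofReal (Real.exp (‖a‖ ^ 2 * κ / 2))
            * ENNReal.ofReal (Real.exp (1 / (2 * κ) * κ)) := by gcongr
      _ ≤ _ := by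
          rw [← ENNReal.ofReal_mul (Real.exp_pos _).le, ← Real.exp_add]
          refine ENNReal.ofReal_le_ofReal (Real.exp_le_exp.2 ?_)
          have : 1 / (2 * κ) * κ = 1 / 2 := by field_simp
          linarith

/-- The linear and quadratic parts are separated as by Cauchy–Schwarz, which doubles both
coefficients; a weighted pointwise AM-GM inequality does this. -/
theorem NormSubGaussian.lintegral_exp_inner_add_sq_le {X : Ω → E} {κ : ℝ}
    (h : NormSubGaussian X κ μ) (hκ : 0 < κ) (hX : Measurable X) (hi : Integrable X μ)
    (h0 : ∫ ω, X ω ∂μ = 0) [CompleteSpace E] (a : E) {p : ℝ} (hp : 0 ≤ p)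
    (hpκ : 2 * p * κ ≤ 1) :
    ∫⁻ ω, ENNReal.ofReal (Real.exp (inner ℝ a (X ω) + p * ‖X ω‖ ^ 2)) ∂μ
      ≤ ENNReal.ofReal (Real.exp (2 * ‖a‖ ^ 2 * κ + p * κ)) := by
  have h1 := h.lintegral_exp_inner_le hκ hX hi h0 ((2 : ℝ) • a)
  have h2 := h.lintegral_exp_mul_sq_le hκ hX (p := 2 * p) (by positivity) hpκ
  -- This weight makes the two halves of the final bound equal.
  set t := p * κ - 2 * ‖a‖ ^ 2 * κ with ht
  have hn : ‖(2 : ℝ) • a‖ ^ 2 = 4 * ‖a‖ ^ 2 := by rw [norm_smul, mul_pow]; norm_num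
  rw [hn] at h1
  calc _ ≤ ∫⁻ ω, (ENNReal.ofReal (Real.exp t / 2)
            * ENNReal.ofReal (Real.exp (inner ℝ ((2 : ℝ) • a) (X ω)))
          + ENNReal.ofReal (Real.exp (-t) / 2)
            * ENNReal.ofReal (Real.exp (2 * p * ‖X ω‖ ^ 2))) ∂μ := by
        refine lintegral_mono fun ω => ?_
        rw [← ENNReal.ofReal_mul (by positivity), ← ENNReal.ofReal_mul (by positivity),
          ← ENNReal.ofReal_add (by positivity) (by positivity)]
        refine ENNReal.ofReal_le_ofReal ?_
        rw [real_inner_smul_left, div_mul_eq_mul_div, div_mul_eq_mul_div, ← Real.exp_add,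
          ← Real.exp_add, ← add_div]
        set u := inner ℝ a (X ω)
        set w := p * ‖X ω‖ ^ 2
        have e1 : Real.exp (t + 2 * u) = Real.exp (t / 2 + u) ^ 2 := by
          rw [← Real.exp_nat_mul]; congr 1; push_cast; ring
        have e2 : Real.exp (-t + 2 * p * ‖X ω‖ ^ 2) = Real.exp (-t / 2 + w) ^ 2 := by
          rw [← Real.exp_nat_mul]; congr 1; push_cast; ring
        have e3 : Real.exp (u + w) = Real.exp (t / 2 + u) * Real.exp (-t / 2 + w) := by
          rw [← Real.exp_add]; congr 1; ring
        rw [e1, e2, e3]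
        linarith [two_mul_le_add_sq (Real.exp (t / 2 + u)) (Real.exp (-t / 2 + w))]
    _ = ENNReal.ofReal (Real.exp t / 2)
            * ∫⁻ ω, ENNReal.ofReal (Real.exp (inner ℝ ((2 : ℝ) • a) (X ω))) ∂μ
          + ENNReal.ofReal (Real.exp (-t) / 2)
            * ∫⁻ ω, ENNReal.ofReal (Real.exp (2 * p * ‖X ω‖ ^ 2)) ∂μ := by
        rw [lintegral_add_left (by fun_prop), lintegral_const_mul _ (by fun_prop),
          lintegral_const_mul _ (by fun_prop)]
    _ ≤ ENNReal.ofReal (Real.exp t / 2) * ENNReal.ofReal (Real.exp (4 * ‖a‖ ^ 2 * κ))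
          + ENNReal.ofReal (Real.exp (-t) / 2) * ENNReal.ofReal (Real.exp (2 * p * κ)) := by
        gcongr
    _ = _ := by
        rw [← ENNReal.ofReal_mul (by positivity), ← ENNReal.ofReal_mul (by positivity),
          ← ENNReal.ofReal_add (by positivity) (by positivity), div_mul_eq_mul_div,
          div_mul_eq_mul_div, ← Real.exp_add, ← Real.exp_add]
        have e1 : t + 4 * ‖a‖ ^ 2 * κ = 2 * ‖a‖ ^ 2 * κ + p * κ := by rw [ht]; ring
        have e2 : -t + 2 * p * κ = 2 * ‖a‖ ^ 2 * κ + p * κ := by rw [ht]; ring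
        rw [e1, e2, add_halves]

/-- If two random elements are independent, integrate out the second one first. -/
theorem ProbabilityTheory.IndepFun.lintegral_le_of_forall {A B : Type*} [MeasurableSpace A]
    [MeasurableSpace B] {X : Ω → A} {Y : Ω → B} (h : IndepFun X Y μ) (hX : Measurable X)
    (hY : Measurable Y) {F : A × B → ℝ≥0∞} (hF : Measurable F) {V : A → ℝ≥0∞}
    (hFV : ∀ a, ∫⁻ ω, F (a, Y ω) ∂μ ≤ V a) :
    ∫⁻ ω, F (X ω, Y ω) ∂μ ≤ ∫⁻ ω, V (X ω) ∂μ := by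
  have hmap := (indepFun_iff_map_prod_eq_prod_map_map hX.aemeasurable hY.aemeasurable).1 h
  have := Measure.isProbabilityMeasure_map (μ := μ) hY.aemeasurable
  have := Measure.isProbabilityMeasure_map (μ := μ) hX.aemeasurable
  calc ∫⁻ ω, F (X ω, Y ω) ∂μ = ∫⁻ z, F z ∂(μ.map fun ω => (X ω, Y ω)) :=
        (lintegral_map hF (hX.prodMk hY)).symm
    _ = ∫⁻ a, ∫⁻ b, F (a, b) ∂(μ.map Y) ∂(μ.map X) := by
        rw [hmap, lintegral_prod _ hF.aemeasurable]
    _ = ∫⁻ ω, ∫⁻ b, F (X ω, b) ∂(μ.map Y) ∂μ :=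
        lintegral_map hF.lintegral_prod_right' hX
    _ ≤ _ := by
        refine lintegral_mono fun ω => ?_
        exact (lintegral_map (hF.comp measurable_prodMk_left) hY).trans_le (hFV _)

/-- Exponential moments of a sum of independent centred norm-sub-Gaussian vectors. -/
theorem lintegral_exp_sum_le_of_normSubGaussian {ι : Type*} {X : ι → Ω → E} {κ : ℝ} (hκ : 0 < κ)
    [CompleteSpace E] (hind : iIndepFun X μ) (hX : ∀ i, Measurable (X i))
    (h : ∀ i, NormSubGaussian (X i) κ μ)
    (hi : ∀ i, Integrable (X i) μ) (h0 : ∀ i, ∫ ω, X i ω ∂μ = 0) (a : E) (s : Finset ι) :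
    ∀ {p : ℝ}, 0 ≤ p → 32 * κ * p * s.card ≤ 1 →
    ∫⁻ ω, ENNReal.ofReal (Real.exp (inner ℝ a (∑ i ∈ s, X i ω) + p * ‖∑ i ∈ s, X i ω‖ ^ 2)) ∂μ
      ≤ ENNReal.ofReal (Real.exp (4 * κ * s.card * ‖a‖ ^ 2 + 2 * p * κ * s.card)) := by
  classical
  -- The exponent `p` stays general: integrating out one summand adds a multiple of `‖S‖²`, so the
  -- remaining sum is needed with `p + 16 κ p²`. The slack in `32 κ p |s| ≤ 1` survives this growth.
  induction s using Finset.induction_on with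
  | empty => intro p _ _; simp
  | insert j s hj ih =>
    intro p hp hps
    rw [Finset.card_insert_of_notMem hj] at hps ⊢
    push_cast at hps ⊢
    set m : ℝ := (s.card : ℝ) with hm
    have hm0 : 0 ≤ m := by positivity
    have hpκ : 0 ≤ κ * p := by positivity
    have hpκm : 0 ≤ κ * p * m := by positivity
    have hIH := ih (p := p + 16 * κ * p ^ 2) (by positivity) (by
      have : 32 * κ * (p + 16 * κ * p ^ 2) * m = 32 * (κ * p * m) + 512 * (κ * p * m) * (κ * p) := by
        ring
      rw [this]
      nlinarith)
    have hsum : IndepFun (fun ω => ∑ i ∈ s, X i ω) (X j) μ := by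
      have := hind.indepFun_finsetSum_of_notMem hX hj
      convert this using 1
      ext ω; simp
    have hstep := hsum.lintegral_le_of_forall (by fun_prop) (hX j)
      (F := fun z => ENNReal.ofReal (Real.exp (inner ℝ a (z.2 + z.1) + p * ‖z.2 + z.1‖ ^ 2)))
      (by fun_prop)
      (V := fun S => ENNReal.ofReal (Real.exp (4 * κ * ‖a‖ ^ 2 + p * κ))
        * ENNReal.ofReal (Real.exp (inner ℝ a S + (p + 16 * κ * p ^ 2) * ‖S‖ ^ 2)))
      (by
        intro S
        have hs := (h j).lintegral_exp_inner_add_sq_le hκ (hX j) (hi j) (h0 j)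
          (a + (2 * p) • S) hp (by nlinarith)
        calc _ = ∫⁻ ω, ENNReal.ofReal (Real.exp (inner ℝ a S + p * ‖S‖ ^ 2))
                * ENNReal.ofReal (Real.exp (inner ℝ (a + (2 * p) • S) (X j ω)
                  + p * ‖X j ω‖ ^ 2)) ∂μ := by
              refine lintegral_congr fun ω => ?_
              rw [← ENNReal.ofReal_mul (Real.exp_pos _).le, ← Real.exp_add, norm_add_sq_real,
                inner_add_right, inner_add_left, real_inner_smul_left, real_inner_comm S (X j ω)]
              congr 2
              ring
          _ = ENNReal.ofReal (Real.exp (inner ℝ a S + p * ‖S‖ ^ 2))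
                * ∫⁻ ω, ENNReal.ofReal (Real.exp (inner ℝ (a + (2 * p) • S) (X j ω)
                  + p * ‖X j ω‖ ^ 2)) ∂μ := by
              have := hX j
              exact lintegral_const_mul _ (by fun_prop)
          _ ≤ _ := by
              refine (mul_le_mul_right hs _).trans ?_
              rw [← ENNReal.ofReal_mul (Real.exp_pos _).le,
                ← ENNReal.ofReal_mul (Real.exp_pos _).le, ← Real.exp_add, ← Real.exp_add]
              refine ENNReal.ofReal_le_ofReal (Real.exp_le_exp.2 ?_)
              -- The cross term `2p⟨S, X⟩` of the square tilts the linear part from `a` to `a +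
              -- 2pS`; the factor `2κ` then yields `4κ‖a‖²` and the increment `16κp²`.
              have hn : ‖a + (2 * p) • S‖ ^ 2 ≤ 2 * ‖a‖ ^ 2 + 8 * p ^ 2 * ‖S‖ ^ 2 := by
                have h1 := norm_add_le a ((2 * p) • S)
                rw [norm_smul, Real.norm_of_nonneg (by positivity : 0 ≤ 2 * p)] at h1
                calc ‖a + (2 * p) • S‖ ^ 2 ≤ (‖a‖ + 2 * p * ‖S‖) ^ 2 := by gcongr
                  _ ≤ _ := by nlinarith [sq_nonneg (‖a‖ - 2 * p * ‖S‖)]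
              nlinarith [mul_le_mul_of_nonneg_left hn hκ.le])
    have heq : ∀ ω, ∑ i ∈ insert j s, X i ω = X j ω + ∑ i ∈ s, X i ω := fun ω =>
      Finset.sum_insert hj
    simp only [heq]
    refine hstep.trans ?_
    rw [lintegral_const_mul _ (by fun_prop)]
    refine (mul_le_mul_right hIH _).trans ?_
    rw [← ENNReal.ofReal_mul (Real.exp_pos _).le, ← Real.exp_add]
    refine ENNReal.ofReal_le_ofReal (Real.exp_le_exp.2 ?_)
    have : κ * p * m * (32 * (κ * p)) ≤ κ * p * 1 := by
      have : κ * p * m * (32 * (κ * p)) = κ * p * (32 * κ * p * m) := by ring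
      rw [this]
      gcongr
      nlinarith
    nlinarith

end SubGaussian

-- Unclipped momentum SGD and the information generated by its samples.

noncomputable section

namespace ByzClip

variable {d n : ℕ} {Ξ Ω : Type*} [MeasurableSpace Ξ]

/-- The average of the vectors of all clients. -/
def average (y : Fin n → RVec d) : RVec d := (1 / (n : ℝ)) • ∑ i, y i

/-- Stochastic gradient descent with client momenta and without clipping: the iterate and the
client buffers. -/
def momentumRun (γ β : ℝ) (sg : Fin n → RVec d → Ξ → RVec d) (x₀ : RVec d) (y : ℕ → Fin n → Ξ) :
    ℕ → RVec d × (Fin n → RVec d)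
  | 0 => (x₀, 0)
  | t + 1 =>
    let s := momentumRun γ β sg x₀ y t
    let x' := s.1 - γ • average s.2
    (x', fun i => (1 - β) • s.2 i + β • sg i x' (y t i))

/-- Unbiased stochastic gradients with norm-sub-Gaussian noise of variance proxy `κ`. -/
structure SubGaussianOracle (f : Fin n → RVec d → ℝ) (D : Fin n → Measure Ξ)
    (sg : Fin n → RVec d → Ξ → RVec d) (κ : ℝ) : Prop where
  measurable : ∀ i, Measurable (fun p : RVec d × Ξ => sg i p.1 p.2)
  integrable : ∀ i x, Integrable (sg i x) (D i)
  unbiased : ∀ i x, ∫ s, sg i x s ∂(D i) = gradient (f i) x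
  subGaussian : ∀ i x, NormSubGaussian (fun s => sg i x s - gradient (f i) x) κ (D i)

/-- Measurable samples that are independent over clients and the first `T` iterations. -/
structure IndepSamples [MeasurableSpace Ω] (T : ℕ) (D : Fin n → Measure Ξ) (μ : Measure Ω)
    (Y : ℕ → Fin n → Ω → Ξ) : Prop where
  measurable : ∀ t i, Measurable (Y t i)
  law : ∀ t < T, ∀ i, μ.map (Y t i) = D i
  indep : iIndepFun (fun (p : Fin T × Fin n) (ω : Ω) => Y p.1 p.2 ω) μ

/-- The information of the samples of the iterations before `t`. -/
@[reducible] def pastSamples (T : ℕ) (Y : ℕ → Fin n → Ω → Ξ) (t : ℕ) : MeasurableSpace Ω :=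
  ⨆ p ∈ {p : Fin T × Fin n | (p.1 : ℕ) < t}, MeasurableSpace.comap (Y p.1 p.2) inferInstance

variable {T : ℕ} {D : Fin n → Measure Ξ} {Y : ℕ → Fin n → Ω → Ξ}
  {f : Fin n → RVec d → ℝ} {sg : Fin n → RVec d → Ξ → RVec d} {L κ γ β : ℝ} {x₀ : RVec d}

theorem pastSamples_mono {s t : ℕ} (h : s ≤ t) : pastSamples T Y s ≤ pastSamples T Y t :=
  biSup_mono fun _ hp => lt_of_lt_of_le hp h

theorem measurable_sample_past {s t : ℕ} (hs : s < T) (hst : s < t) (i : Fin n) :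
    Measurable[pastSamples T Y t] (Y s i) := by
  refine Measurable.of_comap_le ?_
  exact le_iSup₂_of_le (f := fun (p : Fin T × Fin n) (_ : p ∈ {p : Fin T × Fin n | (p.1 : ℕ) < t}) =>
    MeasurableSpace.comap (Y p.1 p.2) inferInstance) (⟨s, hs⟩, i) hst le_rfl

@[fun_prop]
theorem measurable_average : Measurable (average : (Fin n → RVec d) → RVec d) := by
  unfold average; fun_prop

theorem measurable_momentumRun (hsg : ∀ i, Measurable (fun p : RVec d × Ξ => sg i p.1 p.2)) :
    ∀ t ≤ T, Measurable[pastSamples T Y t]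
      (fun ω => momentumRun γ β sg x₀ (fun s i => Y s i ω) t)
  | 0, _ => @measurable_const _ _ _ (_) _
  | t + 1, ht => by
    have ih : Measurable[pastSamples T Y (t + 1)]
        (fun ω => momentumRun γ β sg x₀ (fun s i => Y s i ω) t) :=
      (measurable_momentumRun hsg t (by omega)).mono (pastSamples_mono (Nat.le_succ t)) le_rfl
    -- Sample `t` produces state `t + 1`, so state `t` involves only samples of index below `t`.
    have hY : ∀ i, Measurable[pastSamples T Y (t + 1)] (Y t i) :=
      fun i => measurable_sample_past (by omega) (by omega) i
    let : MeasurableSpace Ω := pastSamples T Y (t + 1)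
    simp only [momentumRun]
    have hx : Measurable fun ω => (momentumRun γ β sg x₀ (fun s i => Y s i ω) t).1
        - γ • average (momentumRun γ β sg x₀ (fun s i => Y s i ω) t).2 := by fun_prop
    refine hx.prodMk (measurable_pi_lambda _ fun i => ?_)
    have h1 : Measurable fun ω => (momentumRun γ β sg x₀ (fun s i => Y s i ω) t).2 i :=
      (measurable_pi_apply i).comp ih.snd
    have h2 := (hsg i).comp (hx.prodMk (hY i))
    exact (h1.const_smul (1 - β)).add (h2.const_smul β)

variable [MeasurableSpace Ω] {μ : Measure Ω}

/-- The index sets `< t` and `= t` are disjoint, hence generate independent σ-algebras; the samples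
of all clients at time `t` are handled jointly. -/
theorem IndepSamples.indepFun_of_measurable_past (h : IndepSamples T D μ Y) {A : Type*}
    [MeasurableSpace A] {Z : Ω → A} {t : ℕ} (ht : t < T) (hZ : Measurable[pastSamples T Y t] Z) :
    IndepFun Z (fun ω i => Y t i ω) μ := by
  have hle : ∀ p : Fin T × Fin n,
      MeasurableSpace.comap (Y p.1 p.2) inferInstance ≤ ‹MeasurableSpace Ω› :=
    fun p => (h.measurable p.1 p.2).comap_le
  have hdisj : Disjoint {p : Fin T × Fin n | (p.1 : ℕ) < t} {p | (p.1 : ℕ) = t} :=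
    Set.disjoint_left.2 fun p hp hq => (ne_of_lt hp) hq
  have hind := indep_iSup_of_disjoint hle ((iIndepFun_iff_iIndep _ _ _).1 h.indep) hdisj
  rw [IndepFun_iff_Indep]
  refine indep_of_indep_of_le_left (indep_of_indep_of_le_right hind ?_) hZ.comap_le
  refine Measurable.comap_le ?_
  refine @measurable_pi_lambda _ _ _ (_) _ _ fun i => ?_
  refine Measurable.of_comap_le ?_
  exact le_iSup₂_of_le (f := fun (p : Fin T × Fin n) (_ : p ∈ {p : Fin T × Fin n | (p.1 : ℕ) = t}) =>
    MeasurableSpace.comap (Y p.1 p.2) inferInstance) (⟨t, ht⟩, i) rfl le_rfl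

theorem IndepSamples.pastSamples_le (h : IndepSamples T D μ Y) (t : ℕ) :
    pastSamples T Y t ≤ ‹MeasurableSpace Ω› :=
  iSup₂_le fun p _ => (h.measurable p.1 p.2).comap_le

theorem SmoothAssumption.continuous_gradient (h : SmoothAssumption Finset.univ f L) (i : Fin n) :
    Continuous (gradient (f i)) := by
  refine (LipschitzWith.of_dist_le_mul (K := L.toNNReal) fun x y => ?_).continuous
  rw [dist_eq_norm, dist_eq_norm]
  refine (h.lipschitz_gradient i (Finset.mem_univ i) x y).trans ?_
  gcongr
  exact Real.le_coe_toNNReal L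

theorem SmoothAssumption.gradient_globalLoss_univ (h : SmoothAssumption Finset.univ f L)
    (x : RVec d) :
    gradient (globalLoss Finset.univ f) x = average fun i => gradient (f i) x := by
  rw [h.gradient_globalLoss, average, Finset.card_univ, Fintype.card_fin]

theorem SmoothAssumption.continuous_gradient_globalLoss (h : SmoothAssumption Finset.univ f L) :
    Continuous (gradient (globalLoss Finset.univ f)) := by
  have : gradient (globalLoss Finset.univ f)
      = fun x => average fun i => gradient (f i) x := funext h.gradient_globalLoss_univ
  rw [this]
  have := h.continuous_gradient
  unfold average
  fun_prop

/-- The Lyapunov function of momentum SGD. -/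
def momentumLyapunov (f : Fin n → RVec d → ℝ) (γ β : ℝ) (s : RVec d × (Fin n → RVec d)) : ℝ :=
  globalLoss Finset.univ f s.1 - (⨅ x, globalLoss Finset.univ f x)
    + γ / β * ‖average s.2 - gradient (globalLoss Finset.univ f) s.1‖ ^ 2

theorem SmoothAssumption.measurable_momentumLyapunov (h : SmoothAssumption Finset.univ f L) :
    Measurable (momentumLyapunov f γ β) := by
  have h1 := h.differentiable_globalLoss.continuous.measurable
  have h2 := h.continuous_gradient_globalLoss.measurable
  unfold momentumLyapunov
  fun_prop

-- The one-step exponential inequality.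

section OneStep

variable [IsProbabilityMeasure μ]

theorem SubGaussianOracle.measurable_noise (ho : SubGaussianOracle f D sg κ) (i : Fin n)
    (x : RVec d) : Measurable fun s => sg i x s - gradient (f i) x :=
  ((ho.measurable i).comp measurable_prodMk_left).sub_const _

/-- The conditional exponential moment of the averaged noise of one iteration. -/
theorem lintegral_exp_averaged_noise_le (hn : 0 < n) (hκ : 0 < κ)
    (ho : SubGaussianOracle f D sg κ) (hY : IndepSamples T D μ Y) {t : ℕ} (ht : t < T)
    (x a : RVec d) {p : ℝ} (hp : 0 ≤ p) (hpκ : 32 * κ * p ≤ n) :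
    ∫⁻ ω, ENNReal.ofReal (Real.exp
        (inner ℝ a (average fun i => sg i x (Y t i ω) - gradient (f i) x)
          + p * ‖average fun i => sg i x (Y t i ω) - gradient (f i) x‖ ^ 2)) ∂μ
      ≤ ENNReal.ofReal (Real.exp (4 * κ / n * ‖a‖ ^ 2 + 2 * p * κ / n)) := by
  have hn' : (0 : ℝ) < n := by exact_mod_cast hn
  have hm := ho.measurable_noise
  have hprec : Function.Injective fun i : Fin n => ((⟨t, ht⟩, i) : Fin T × Fin n) :=
    fun i j hij => (Prod.ext_iff.1 hij).2
  have hind : iIndepFun (fun i ω => sg i x (Y t i ω) - gradient (f i) x) μ :=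
    (hY.indep.precomp hprec).comp (fun i s => sg i x s - gradient (f i) x) fun i => hm i x
  have key := lintegral_exp_sum_le_of_normSubGaussian hκ hind
    (fun i => (hm i x).comp (hY.measurable t i))
    (fun i => by
      have := ho.subGaussian i x
      rw [NormSubGaussian, ← hY.law t ht i, lintegral_map _ (hY.measurable t i)] at this
      · exact this
      · have := hm i x
        fun_prop)
    (fun i => by
      have : IsProbabilityMeasure (D i) := by
        rw [← hY.law t ht i]
        exact Measure.isProbabilityMeasure_map (hY.measurable t i).aemeasurable
      have : Integrable (fun s => sg i x s - gradient (f i) x) (D i) :=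
        (ho.integrable i x).sub (integrable_const _)
      rw [← hY.law t ht i] at this
      exact this.comp_measurable (hY.measurable t i))
    (fun i => by
      have : IsProbabilityMeasure (D i) := by
        rw [← hY.law t ht i]
        exact Measure.isProbabilityMeasure_map (hY.measurable t i).aemeasurable
      have h1 : ∫ s, (sg i x s - gradient (f i) x) ∂(D i) = 0 := by
        rw [integral_sub (ho.integrable i x) (integrable_const _), ho.unbiased i x]
        simp
      rwa [← hY.law t ht i, integral_map (hY.measurable t i).aemeasurable
        (hm i x).aestronglyMeasurable] at h1)
    -- Rescaling the sum to an average divides `a` by `n` and `p` by `n²`; after summing `n` clients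
    -- a gain of `1/n` remains.
    ((1 / (n : ℝ)) • a) Finset.univ (p := p / n ^ 2) (by positivity) (by
      rw [Finset.card_univ, Fintype.card_fin]
      have : 32 * κ * (p / n ^ 2) * n = 32 * κ * p / n := by field_simp
      rw [this, div_le_one hn']
      exact hpκ)
  have hnorm : ‖(1 / (n : ℝ)) • a‖ ^ 2 = ‖a‖ ^ 2 / n ^ 2 := by
    rw [norm_smul, Real.norm_of_nonneg (by positivity)]; field_simp
  rw [Finset.card_univ, Fintype.card_fin, hnorm] at key
  have e1 : ∀ ω, inner ℝ a (average fun i => sg i x (Y t i ω) - gradient (f i) x)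
      + p * ‖average fun i => sg i x (Y t i ω) - gradient (f i) x‖ ^ 2
      = inner ℝ ((1 / (n : ℝ)) • a) (∑ i, (sg i x (Y t i ω) - gradient (f i) x))
        + p / n ^ 2 * ‖∑ i, (sg i x (Y t i ω) - gradient (f i) x)‖ ^ 2 := fun ω => by
    rw [average, real_inner_smul_left, real_inner_smul_right, norm_smul,
      Real.norm_of_nonneg (by positivity), mul_pow]
    ring
  have e2 : 4 * κ / n * ‖a‖ ^ 2 + 2 * p * κ / n
      = 4 * κ * n * (‖a‖ ^ 2 / n ^ 2) + 2 * (p / n ^ 2) * κ * n := by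
    generalize ‖a‖ = z
    field_simp
  simp only [e1]
  rw [e2]
  exact key

/-- The exponentiated Lyapunov function is a supermartingale: the conditional step. -/
theorem lintegral_exp_momentumLyapunov_step_le (hn : 0 < n) (hκ : 0 < κ) (hL : 0 < L)
    (hβ : 0 < β) (hβ1 : β ≤ 1) (hγ : 12 * L * γ = β) (hf : SmoothAssumption Finset.univ f L)
    (ho : SubGaussianOracle f D sg κ) (hY : IndepSamples T D μ Y) {t : ℕ} (ht : t < T)
    (s : RVec d × (Fin n → RVec d)) (r : ℝ) :
    let x' := s.1 - γ • average s.2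
    ∫⁻ ω, ENNReal.ofReal (Real.exp (n / (128 * γ * κ) *
        (momentumLyapunov f γ β (x', fun i => (1 - β) • s.2 i + β • sg i x' (Y t i ω))
          + γ / 2 * (r + ‖gradient (globalLoss Finset.univ f) s.1‖ ^ 2)
          - 2 * γ * β * κ / n))) ∂μ
      ≤ ENNReal.ofReal (Real.exp (n / (128 * γ * κ) *
          (momentumLyapunov f γ β s + γ / 2 * r))) := by
  intro x'
  have hγ0 : 0 < γ := by nlinarith
  have hn' : (0 : ℝ) < n := by exact_mod_cast hn
  set lam : ℝ := n / (128 * γ * κ) with hlam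
  have hlam0 : 0 < lam := by positivity
  set a := average s.2 - gradient (globalLoss Finset.univ f) x' with ha
  set q := lam * (momentumLyapunov f γ β s + γ / 2 * r) with hq
  have havg : ∀ ω, average (fun i => (1 - β) • s.2 i + β • sg i x' (Y t i ω))
      = (1 - β) • average s.2 + β • (gradient (globalLoss Finset.univ f) x'
        + average fun i => sg i x' (Y t i ω) - gradient (f i) x') := by
    intro ω
    rw [hf.gradient_globalLoss_univ]
    simp only [average, Finset.sum_add_distrib, Finset.sum_sub_distrib, ← Finset.smul_sum]
    module
  -- The vector `a` depends only on the old state, so it is a constant when the new sample is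
  -- integrated out.
  have hnoise := lintegral_exp_averaged_noise_le hn hκ ho hY ht x'
    ((lam * (2 * γ * (1 - β))) • a) (p := lam * (γ * β)) (by positivity) (by
      have : 32 * κ * (lam * (γ * β)) = n * (β / 4) := by rw [hlam]; field_simp; norm_num
      rw [this]
      nlinarith)
  have hmeas : Measurable fun ω => average fun i => sg i x' (Y t i ω) - gradient (f i) x' :=
    measurable_average.comp (measurable_pi_lambda _ fun i =>
      (ho.measurable_noise i x').comp (hY.measurable t i))
  set θ : Ω → RVec d := fun ω => average fun i => sg i x' (Y t i ω) - gradient (f i) x' with hθ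
  calc _ ≤ ∫⁻ ω, ENNReal.ofReal (Real.exp (q - lam * (γ / 8 * ‖a‖ ^ 2 + 2 * γ * β * κ / n)))
        * ENNReal.ofReal (Real.exp (inner ℝ ((lam * (2 * γ * (1 - β))) • a) (θ ω)
          + lam * (γ * β) * ‖θ ω‖ ^ 2)) ∂μ := by
        refine lintegral_mono fun ω => ?_
        rw [← ENNReal.ofReal_mul (Real.exp_pos _).le, ← Real.exp_add]
        refine ENNReal.ofReal_le_ofReal (Real.exp_le_exp.2 ?_)
        have hstep := momentum_lyapunov_step hL hf.differentiable_globalLoss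
          (hf.lipschitz_globalLoss (by simpa using hn)) hβ hβ1 hγ s.1 (average s.2) (θ ω)
        simp only at hstep
        rw [real_inner_smul_left, hq, mul_assoc lam (γ * β), mul_assoc lam (2 * γ * (1 - β)),
          ← mul_sub, ← mul_add, ← mul_add]
        refine mul_le_mul_of_nonneg_left ?_ hlam0.le
        simp only [momentumLyapunov, havg ω]
        linarith
    _ = ENNReal.ofReal (Real.exp (q - lam * (γ / 8 * ‖a‖ ^ 2 + 2 * γ * β * κ / n)))
        * ∫⁻ ω, ENNReal.ofReal (Real.exp (inner ℝ ((lam * (2 * γ * (1 - β))) • a) (θ ω)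
          + lam * (γ * β) * ‖θ ω‖ ^ 2)) ∂μ := lintegral_const_mul _ (by fun_prop)
    _ ≤ _ := by
        refine (mul_le_mul_right hnoise _).trans ?_
        rw [← ENNReal.ofReal_mul (Real.exp_pos _).le, ← Real.exp_add]
        refine ENNReal.ofReal_le_ofReal (Real.exp_le_exp.2 ?_)
        rw [norm_smul, mul_pow, Real.norm_eq_abs, sq_abs]
        -- The value `128` in `lam` makes the cost of the linear noise term equal to the available
        -- `γ/8 ‖a‖²`, up to the factor `(1 - β)² ≤ 1`.
        have e1 : 4 * κ / n * ((lam * (2 * γ * (1 - β))) ^ 2 * ‖a‖ ^ 2)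
            = lam * (γ / 8 * ‖a‖ ^ 2) * (1 - β) ^ 2 := by
          generalize ‖a‖ = z
          rw [hlam]; field_simp; ring
        have e2 : 2 * (lam * (γ * β)) * κ / n = lam * (2 * γ * β * κ / n) := by ring
        rw [e1, e2]
        have h1 : (1 - β) ^ 2 ≤ 1 := by nlinarith
        have h2 : lam * (γ / 8 * ‖a‖ ^ 2) * (1 - β) ^ 2 ≤ lam * (γ / 8 * ‖a‖ ^ 2) :=
          mul_le_of_le_one_right (by positivity) h1
        linarith

end OneStep

end ByzClip

-- The exponential supermartingale and its tail bounds.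

namespace ByzClip

variable {d n : ℕ} {Ξ Ω : Type*} [MeasurableSpace Ξ] [MeasurableSpace Ω] {μ : Measure Ω}
  {T : ℕ} {D : Fin n → Measure Ξ} {Y : ℕ → Fin n → Ω → Ξ}
  {f : Fin n → RVec d → ℝ} {sg : Fin n → RVec d → Ξ → RVec d} {L κ γ β : ℝ} {x₀ : RVec d}

/-- The sum of the squared gradient norms over the first `t` iterates of momentum SGD. -/
def sumSqGrad (f : Fin n → RVec d → ℝ) (γ β : ℝ) (sg : Fin n → RVec d → Ξ → RVec d) (x₀ : RVec d)
    (y : ℕ → Fin n → Ξ) (t : ℕ) : ℝ :=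
  ∑ s ∈ Finset.range t,
    ‖gradient (globalLoss Finset.univ f) (momentumRun γ β sg x₀ y s).1‖ ^ 2

section Tails

variable [IsProbabilityMeasure μ]

/-- A supermartingale argument without conditional expectations: the past is independent of the new
sample, so the one-step inequality for each fixed state is integrated over the past. -/
theorem lintegral_exp_momentumLyapunov_le (hn : 0 < n) (hκ : 0 < κ) (hL : 0 < L)
    (hβ : 0 < β) (hβ1 : β ≤ 1) (hγ : 12 * L * γ = β) (hf : SmoothAssumption Finset.univ f L)
    (ho : SubGaussianOracle f D sg κ) (hY : IndepSamples T D μ Y) :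
    ∀ t ≤ T, ∫⁻ ω, ENNReal.ofReal (Real.exp (n / (128 * γ * κ) *
        (momentumLyapunov f γ β (momentumRun γ β sg x₀ (fun s i => Y s i ω) t)
          + γ / 2 * sumSqGrad f γ β sg x₀ (fun s i => Y s i ω) t
          - t * (2 * γ * β * κ / n)))) ∂μ
      ≤ ENNReal.ofReal (Real.exp (n / (128 * γ * κ) * momentumLyapunov f γ β (x₀, 0)))
  | 0, _ => by simp [momentumRun, sumSqGrad]
  | t + 1, ht => by
    refine le_trans ?_ (lintegral_exp_momentumLyapunov_le hn hκ hL hβ hβ1 hγ hf ho hY t (by omega))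
    set lam : ℝ := n / (128 * γ * κ) with hlam
    set c : ℝ := 2 * γ * β * κ / n with hc
    have hgrad := hf.continuous_gradient_globalLoss.measurable
    have hlyap := hf.measurable_momentumLyapunov (γ := γ) (β := β)
    have hrun : ∀ s ≤ t, Measurable[pastSamples T Y t]
        (fun ω => momentumRun γ β sg x₀ (fun s i => Y s i ω) s) := fun s hs =>
      (measurable_momentumRun ho.measurable s (by omega)).mono (pastSamples_mono hs) le_rfl
    have hsum : Measurable[pastSamples T Y t]
        (fun ω => sumSqGrad f γ β sg x₀ (fun s i => Y s i ω) t) := by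
      let : MeasurableSpace Ω := pastSamples T Y t
      unfold sumSqGrad
      refine Finset.measurable_sum _ fun s hs => ?_
      exact ((hgrad.comp (hrun s (Finset.mem_range.1 hs).le).fst).norm).pow_const 2
    -- The running gradient sum is carried along with the state, so that the whole exponent is a
    -- function of this pair and the fresh samples.
    have hZ : Measurable[pastSamples T Y t] (fun ω =>
        (momentumRun γ β sg x₀ (fun s i => Y s i ω) t,
          sumSqGrad f γ β sg x₀ (fun s i => Y s i ω) t)) := by
      let : MeasurableSpace Ω := pastSamples T Y t
      exact (hrun t le_rfl).prodMk hsum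
    have hZ' := hZ.mono (hY.pastSamples_le t) le_rfl
    have hind := hY.indepFun_of_measurable_past (by omega) hZ
    have hYm : Measurable fun ω i => Y t i ω := measurable_pi_lambda _ fun i => hY.measurable t i
    have hnext : Measurable fun z : ((RVec d × (Fin n → RVec d)) × ℝ) × (Fin n → Ξ) =>
        ((z.1.1.1 - γ • average z.1.1.2, fun i => (1 - β) • z.1.1.2 i
          + β • sg i (z.1.1.1 - γ • average z.1.1.2) (z.2 i)) : RVec d × (Fin n → RVec d)) := by
      have hx : Measurable fun z : ((RVec d × (Fin n → RVec d)) × ℝ) × (Fin n → Ξ) =>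
        z.1.1.1 - γ • average z.1.1.2 := by fun_prop
      refine hx.prodMk (measurable_pi_lambda _ fun i => ?_)
      have h2 := (ho.measurable i).comp
        (hx.prodMk ((measurable_pi_apply i).comp measurable_snd))
      have h1 : Measurable fun z : ((RVec d × (Fin n → RVec d)) × ℝ) × (Fin n → Ξ) =>
        z.1.1.2 i := by fun_prop
      exact (h1.const_smul (1 - β)).add (h2.const_smul β)
    have hgx : Measurable fun z : ((RVec d × (Fin n → RVec d)) × ℝ) × (Fin n → Ξ) =>
        gradient (globalLoss Finset.univ f) z.1.1.1 :=
      hgrad.comp measurable_fst.fst.fst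
    have hly : Measurable fun z : ((RVec d × (Fin n → RVec d)) × ℝ) × (Fin n → Ξ) =>
        momentumLyapunov f γ β (z.1.1.1 - γ • average z.1.1.2, fun i => (1 - β) • z.1.1.2 i
          + β • sg i (z.1.1.1 - γ • average z.1.1.2) (z.2 i)) := hlyap.comp hnext
    have hmain := hind.lintegral_le_of_forall hZ' hYm
      (F := fun z => ENNReal.ofReal (Real.exp (-(lam * (t * c)))) *
        ENNReal.ofReal (Real.exp (lam *
        (momentumLyapunov f γ β (z.1.1.1 - γ • average z.1.1.2, fun i => (1 - β) • z.1.1.2 i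
          + β • sg i (z.1.1.1 - γ • average z.1.1.2) (z.2 i))
          + γ / 2 * (z.1.2 + ‖gradient (globalLoss Finset.univ f) z.1.1.1‖ ^ 2) - c))))
      (V := fun a => ENNReal.ofReal (Real.exp (-(lam * (t * c)))) *
        ENNReal.ofReal (Real.exp (lam * (momentumLyapunov f γ β a.1 + γ / 2 * a.2))))
      (by fun_prop)
      (fun a => by
        refine (lintegral_const_mul' _ _ ENNReal.ofReal_ne_top).trans_le ?_
        exact mul_le_mul_right (lintegral_exp_momentumLyapunov_step_le hn hκ hL hβ hβ1 hγ hf ho hY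
          (by omega) a.1 a.2) _)
    simp only [← ENNReal.ofReal_mul (Real.exp_pos _).le, ← Real.exp_add] at hmain
    refine le_of_eq_of_le (lintegral_congr fun ω => ?_) (hmain.trans_eq (lintegral_congr fun ω => ?_))
    · rw [sumSqGrad, Finset.sum_range_succ, ← sumSqGrad]
      congr 2
      simp only [momentumRun]
      push_cast
      ring
    · congr 2
      ring

theorem measure_momentumLyapunov_gt_le (hn : 0 < n) (hκ : 0 < κ) (hL : 0 < L)
    (hβ : 0 < β) (hβ1 : β ≤ 1) (hγ : 12 * L * γ = β) (hf : SmoothAssumption Finset.univ f L)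
    (ho : SubGaussianOracle f D sg κ) (hY : IndepSamples T D μ Y) {t : ℕ} (ht : t ≤ T) (r : ℝ) :
    μ {ω | momentumLyapunov f γ β (x₀, 0) + t * (2 * γ * β * κ / n) + 128 * γ * κ / n * r
        < momentumLyapunov f γ β (momentumRun γ β sg x₀ (fun s i => Y s i ω) t)
          + γ / 2 * sumSqGrad f γ β sg x₀ (fun s i => Y s i ω) t}
      ≤ ENNReal.ofReal (Real.exp (-r)) := by
  have hγ0 : 0 < γ := by nlinarith
  have hn' : (0 : ℝ) < n := by exact_mod_cast hn
  have hint := lintegral_exp_momentumLyapunov_le (x₀ := x₀) hn hκ hL hβ hβ1 hγ hf ho hY t ht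
  set lam : ℝ := n / (128 * γ * κ) with hlam
  have hlam0 : 0 < lam := by positivity
  set Φ₀ := momentumLyapunov f γ β (x₀, 0)
  set F : Ω → ℝ≥0∞ := fun ω => ENNReal.ofReal (Real.exp (lam *
        (momentumLyapunov f γ β (momentumRun γ β sg x₀ (fun s i => Y s i ω) t)
          + γ / 2 * sumSqGrad f γ β sg x₀ (fun s i => Y s i ω) t
          - t * (2 * γ * β * κ / n)))) with hF
  have hFm : Measurable F := by
    have hgrad := hf.continuous_gradient_globalLoss.measurable
    have hrun : ∀ s ≤ T, Measurable
        (fun ω => momentumRun γ β sg x₀ (fun s i => Y s i ω) s) := fun s hs =>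
      (measurable_momentumRun ho.measurable s hs).mono (hY.pastSamples_le s) le_rfl
    have h1 := (hf.measurable_momentumLyapunov (γ := γ) (β := β)).comp (hrun t ht)
    have h2 : Measurable (fun ω => sumSqGrad f γ β sg x₀ (fun s i => Y s i ω) t) := by
      unfold sumSqGrad
      refine Finset.measurable_sum _ fun s hs => ?_
      exact ((hgrad.comp (hrun s (by have := Finset.mem_range.1 hs; omega)).fst).norm).pow_const 2
    simp only [Function.comp_def] at h1
    fun_prop
  -- Markov's inequality at `exp(lam Φ₀ + r)`; the integral bound cancels `exp(lam Φ₀)` and leaves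
  -- `exp(-r)`.
  have hmk := mul_meas_ge_le_lintegral (μ := μ) hFm
    (ENNReal.ofReal (Real.exp (lam * Φ₀ + r)))
  refine (measure_mono (t := {ω | ENNReal.ofReal (Real.exp (lam * Φ₀ + r)) ≤ F ω}) ?_).trans ?_
  · intro ω hω
    refine ENNReal.ofReal_le_ofReal (Real.exp_le_exp.2 ?_)
    have hω' := mul_le_mul_of_nonneg_left (le_of_lt hω) hlam0.le
    have : lam * (128 * γ * κ / n * r) = r := by rw [hlam]; field_simp
    linarith
  · have h1 := hmk.trans hint
    rw [Real.exp_add, ENNReal.ofReal_mul (Real.exp_pos _).le, mul_assoc] at h1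
    have h2 : ENNReal.ofReal (Real.exp r) * μ {ω | ENNReal.ofReal (Real.exp (lam * Φ₀ + r)) ≤ F ω}
        ≤ 1 := by
      rw [Real.exp_add, ENNReal.ofReal_mul (Real.exp_pos _).le]
      refine (ENNReal.mul_le_mul_iff_right (a := ENNReal.ofReal (Real.exp (lam * Φ₀)))
        (by simp [Real.exp_pos]) ENNReal.ofReal_ne_top).1 ?_
      rwa [mul_one]
    rw [Real.exp_neg, ENNReal.ofReal_inv_of_pos (Real.exp_pos _)]
    rw [← one_div, ENNReal.le_div_iff_mul_le (.inl (by simp [Real.exp_pos]))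
      (.inl ENNReal.ofReal_ne_top), mul_comm]
    exact h2

/-- The query point is determined by the past, so independence makes the noise there
norm-sub-Gaussian with the same proxy as at a fixed point. -/
theorem measure_noise_gt_le (hκ : 0 < κ) (hf : SmoothAssumption Finset.univ f L)
    (ho : SubGaussianOracle f D sg κ) (hY : IndepSamples T D μ Y) {t : ℕ} (ht : t < T) (i : Fin n)
    (r : ℝ) {X : (RVec d × (Fin n → RVec d)) → RVec d} (hX : Measurable X) :
    μ {ω | r * κ < ‖sg i (X (momentumRun γ β sg x₀ (fun s i => Y s i ω) t)) (Y t i ω)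
        - gradient (f i) (X (momentumRun γ β sg x₀ (fun s i => Y s i ω) t))‖ ^ 2}
      ≤ ENNReal.ofReal (Real.exp (1 - r)) := by
  have hrun := measurable_momentumRun (γ := γ) (β := β) (x₀ := x₀) (T := T) (Y := Y)
    ho.measurable t ht.le
  have hXm : Measurable[pastSamples T Y t]
      fun ω => X (momentumRun γ β sg x₀ (fun s i => Y s i ω) t) := hX.comp hrun
  have hXm' := hXm.mono (hY.pastSamples_le t) le_rfl
  have hind := (hY.indepFun_of_measurable_past ht hXm).comp measurable_id (measurable_pi_apply i)
  have hg := (hf.continuous_gradient i).measurable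
  have hnoise : Measurable fun z : RVec d × Ξ => sg i z.1 z.2 - gradient (f i) z.1 :=
    (ho.measurable i).sub (hg.comp measurable_fst)
  refine NormSubGaussian.measure_lt_norm_sq_le ?_ hκ
    (hnoise.comp (hXm'.prodMk (hY.measurable t i))) r
  have := hind.lintegral_le_of_forall hXm' (hY.measurable t i)
    (F := fun z => ENNReal.ofReal (Real.exp (‖sg i z.1 z.2 - gradient (f i) z.1‖ ^ 2 / κ)))
    (V := fun _ => ENNReal.ofReal (Real.exp 1)) (by fun_prop) (fun x => by
      have h1 := ho.subGaussian i x
      rw [NormSubGaussian, ← hY.law t ht i, lintegral_map _ (hY.measurable t i)] at h1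
      · exact h1
      · have := ho.measurable_noise i x
        fun_prop)
  simpa [NormSubGaussian] using this

end Tails

end ByzClip

-- Inactive clipping along controlled trajectories.

namespace ByzClip

variable {d n : ℕ} {Ξ Ω : Type*} {T : ℕ}
  {f : Fin n → RVec d → ℝ} {sg : Fin n → RVec d → Ξ → RVec d} {L γ β : ℝ} {x₀ : RVec d}

theorem clip_of_norm_le {τ : ℝ} {x : RVec d} (h : ‖x‖ ≤ τ) : clip τ x = x := if_pos h

/-- As long as clipping is inactive, the algorithm is momentum SGD. -/
theorem run_eq_momentumRun {τ : ℝ} {RAgg : (Fin n → RVec d) → RVec d}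
    (hR : ∀ y, RAgg y = average y) {ξ : ℕ → Fin n → Ω → Ξ} {W byz : ℕ → Fin n → Ω → RVec d} {ω : Ω}
    (hW : ∀ t < T, ∀ i, W (t + 1) i ω = 0) {y : ℕ → Fin n → Ξ}
    (hy : ∀ t < T, ∀ i, ξ (t + 1) i ω = y t i)
    (hclip : ∀ t < T, ∀ i, ‖(momentumRun γ β sg x₀ y (t + 1)).2 i
      - (momentumRun γ β sg x₀ y t).2 i‖ ≤ τ) :
    ∀ t ≤ T, run Finset.univ RAgg γ β 1 τ sg x₀ ξ W byz ω t
      = { x := (momentumRun γ β sg x₀ y t).1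
          v := (momentumRun γ β sg x₀ y t).2
          g := (momentumRun γ β sg x₀ y t).2
          m := (momentumRun γ β sg x₀ y t).2 }
  | 0, _ => rfl
  | t + 1, ht => by
    have ih := run_eq_momentumRun hR hW hy hclip (byz := byz) t (by omega)
    have hc : ∀ i, clip τ ((momentumRun γ β sg x₀ y (t + 1)).2 i
      - (momentumRun γ β sg x₀ y t).2 i) = _ :=
      fun i => clip_of_norm_le (hclip t (by omega) i)
    simp only [momentumRun] at hc
    simp only [run, ih, step, hR, Finset.mem_univ, if_true, momentumRun, hc, one_smul,
      hW t (by omega), hy t (by omega), add_zero, add_sub_cancel]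

/-- The Lyapunov function controls the gradient and the averaged momentum. -/
theorem norm_average_momentum_le (hn : 0 < n) (hL : 0 < L) (hβ : 0 < β)
    (hγ : 12 * L * γ = β) (hf : SmoothAssumption Finset.univ f L) {Δ : ℝ} (hΔ : 0 ≤ Δ)
    {s : RVec d × (Fin n → RVec d)} (hs : momentumLyapunov f γ β s ≤ 2 * Δ) :
    ‖average s.2‖ ≤ 7 * Real.sqrt (L * Δ) := by
  have hγ0 : 0 < γ := by nlinarith
  have hinf : ∀ x, (⨅ x, globalLoss Finset.univ f x) ≤ globalLoss Finset.univ f x :=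
    fun x => ciInf_le hf.bddBelow x
  have h1 := sq_norm_gradient_le hL hf.differentiable_globalLoss
    (hf.lipschitz_globalLoss (by simpa using hn)) hinf s.1
  have h0 := hinf s.1
  set u := average s.2 - gradient (globalLoss Finset.univ f) s.1 with hu
  have hu0 : 0 ≤ γ / β * ‖u‖ ^ 2 := by positivity
  rw [momentumLyapunov, ← hu] at hs
  have hsq : Real.sqrt (L * Δ) ^ 2 = L * Δ := Real.sq_sqrt (by positivity)
  have h2 : ‖gradient (globalLoss Finset.univ f) s.1‖ ≤ 2 * Real.sqrt (L * Δ) := by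
    refine abs_le_of_sq_le_sq' ?_ (by positivity) |>.2
    rw [mul_pow, hsq]
    nlinarith
  -- Since `γ/β = 1/(12L)`, the bound `2Δ` gives `‖u‖² ≤ 24 L Δ`.
  have h3 : ‖u‖ ≤ 5 * Real.sqrt (L * Δ) := by
    refine abs_le_of_sq_le_sq' ?_ (by positivity) |>.2
    rw [mul_pow, hsq]
    have h4 : γ / β * ‖u‖ ^ 2 ≤ 2 * Δ := by linarith
    have h5 : γ / β = 1 / (12 * L) := by rw [← hγ]; field_simp
    rw [h5, one_div, inv_mul_le_iff₀ (by positivity)] at h4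
    nlinarith [mul_nonneg hL.le hΔ]
  calc ‖average s.2‖ = ‖u + gradient (globalLoss Finset.univ f) s.1‖ := by rw [hu, sub_add_cancel]
    _ ≤ ‖u‖ + ‖gradient (globalLoss Finset.univ f) s.1‖ := norm_add_le _ _
    _ ≤ _ := by linarith

/-- While the Lyapunov function and the noise are controlled, client momenta move slowly. -/
theorem norm_momentum_increment_le (hn : 0 < n) (hL : 0 < L) (hβ : 0 < β) (hβ1 : β ≤ 1)
    (hγ : 12 * L * γ = β) (hf : SmoothAssumption Finset.univ f L) {Δ M b : ℝ} (hΔ : 0 ≤ Δ)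
    (hM : ∀ i, ‖gradient (f i) x₀‖ ≤ M) (hb : 0 ≤ b) {y : ℕ → Fin n → Ξ}
    (hlyap : ∀ t ≤ T, momentumLyapunov f γ β (momentumRun γ β sg x₀ y t) ≤ 2 * Δ)
    (hnoise : ∀ t < T, ∀ i, ‖sg i (momentumRun γ β sg x₀ y (t + 1)).1 (y t i)
      - gradient (f i) (momentumRun γ β sg x₀ y (t + 1)).1‖ ≤ b) (i : Fin n) :
    ∀ t < T, ‖(momentumRun γ β sg x₀ y (t + 1)).2 i - (momentumRun γ β sg x₀ y t).2 i‖
      ≤ β * (M + 2 * b + Real.sqrt (L * Δ)) := by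
  set r := Real.sqrt (L * Δ) with hr
  have hγ0 : 0 < γ := by nlinarith
  have hM0 : 0 ≤ M := (norm_nonneg _).trans (hM i)
  have hr0 : 0 ≤ r := Real.sqrt_nonneg _
  -- The increment is `β` times the noise minus the lag `v_i^t - ∇f_i(x^{t+1})`. The lag obeys a `(1
  -- - β)`-contraction with input `β (b + 7r/12)`, so the level `M + b + r` is invariant. It holds
  -- at time zero because zero momenta give `x¹ = x⁰`.
  have hw : ∀ t < T, ‖(momentumRun γ β sg x₀ y t).2 i
      - gradient (f i) (momentumRun γ β sg x₀ y (t + 1)).1‖ ≤ M + b + r := by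
    intro t
    induction t with
    | zero =>
      intro _
      have : average (0 : Fin n → RVec d) = 0 := by simp [average]
      simp only [momentumRun, this, smul_zero, sub_zero, Pi.zero_apply, zero_sub, norm_neg]
      linarith [hM i]
    | succ t ih =>
      intro ht
      have h1 := ih (by omega)
      have h2 := hnoise t (by omega) i
      have h3 := norm_average_momentum_le hn hL hβ hγ hf hΔ (hlyap (t + 1) ht.le)
      set x' := (momentumRun γ β sg x₀ y (t + 1)).1 with hx'
      set x'' := (momentumRun γ β sg x₀ y (t + 1 + 1)).1 with hx''
      have hxx : x' - x'' = γ • average (momentumRun γ β sg x₀ y (t + 1)).2 := by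
        simp only [hx', hx'']
        rw [momentumRun]
        exact sub_sub_cancel _ _
      have h4 := hf.lipschitz_gradient i (Finset.mem_univ i) x' x''
      rw [hxx, norm_smul, Real.norm_of_nonneg hγ0.le] at h4
      have hv : (momentumRun γ β sg x₀ y (t + 1)).2 i
          = (1 - β) • (momentumRun γ β sg x₀ y t).2 i + β • sg i x' (y t i) := rfl
      have hdec : (momentumRun γ β sg x₀ y (t + 1)).2 i - gradient (f i) x''
          = (1 - β) • ((momentumRun γ β sg x₀ y t).2 i - gradient (f i) x')
            + β • (sg i x' (y t i) - gradient (f i) x')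
            + (gradient (f i) x' - gradient (f i) x'') := by
        rw [hv]; module
      rw [hdec]
      refine norm_add₃_le.trans ?_
      rw [norm_smul, norm_smul, Real.norm_of_nonneg (by linarith), Real.norm_of_nonneg hβ.le]
      have h5 : ‖gradient (f i) x' - gradient (f i) x''‖ ≤ β * (7 / 12 * r) := by
        calc _ ≤ L * (γ * ‖average (momentumRun γ β sg x₀ y (t + 1)).2‖) := h4
          _ ≤ L * (γ * (7 * r)) := by gcongr
          _ = _ := by rw [← hγ]; ring
      have h6 := mul_le_mul_of_nonneg_left h1 (by linarith : 0 ≤ 1 - β)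
      have h7 := mul_le_mul_of_nonneg_left h2 hβ.le
      have h8 : 0 ≤ β * M := by positivity
      have h9 : 0 ≤ β * r := by positivity
      linarith
  intro t ht
  have h1 := hw t ht
  have h2 := hnoise t ht i
  set x' := (momentumRun γ β sg x₀ y (t + 1)).1 with hx'
  have hv : (momentumRun γ β sg x₀ y (t + 1)).2 i
      = (1 - β) • (momentumRun γ β sg x₀ y t).2 i + β • sg i x' (y t i) := rfl
  have hdec : (momentumRun γ β sg x₀ y (t + 1)).2 i - (momentumRun γ β sg x₀ y t).2 i
      = β • ((sg i x' (y t i) - gradient (f i) x')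
        - ((momentumRun γ β sg x₀ y t).2 i - gradient (f i) x')) := by
    rw [hv]; module
  rw [hdec, norm_smul, Real.norm_of_nonneg hβ.le]
  gcongr
  refine (norm_sub_le _ _).trans ?_
  linarith

end ByzClip

-- The good event and its probability.

namespace ByzClip

variable {d n : ℕ} {Ξ Ω : Type*} [MeasurableSpace Ξ] [MeasurableSpace Ω] {μ : Measure Ω}
  [IsProbabilityMeasure μ]
  {T : ℕ} {D : Fin n → Measure Ξ} {Y : ℕ → Fin n → Ω → Ξ}
  {f : Fin n → RVec d → ℝ} {sg : Fin n → RVec d → Ξ → RVec d} {L κ γ β : ℝ} {x₀ : RVec d}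

/-- With high probability the Lyapunov function stays below `2Δ`, the gradients are summable and
all noises are bounded. -/
theorem measure_not_controlled_le (hn : 0 < n) (hκ : 0 < κ) (hL : 0 < L)
    (hβ : 0 < β) (hβ1 : β ≤ 1) (hγ : 12 * L * γ = β) (hf : SmoothAssumption Finset.univ f L)
    (ho : SubGaussianOracle f D sg κ) (hY : IndepSamples T D μ Y) {Δ r : ℝ}
    (hΔ : momentumLyapunov f γ β (x₀, 0) ≤ Δ)
    (hdrift : β ^ 2 * T * κ ≤ 3 * L * Δ * n) (hdev : 64 * β * κ * r ≤ 3 * L * Δ * n) :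
    μ {ω | ¬ ((∀ t ≤ T, momentumLyapunov f γ β (momentumRun γ β sg x₀ (fun s i => Y s i ω) t)
          + γ / 2 * sumSqGrad f γ β sg x₀ (fun s i => Y s i ω) t ≤ 2 * Δ) ∧
        ∀ t < T, ∀ i, ‖sg i (momentumRun γ β sg x₀ (fun s i => Y s i ω) (t + 1)).1 (Y t i ω)
          - gradient (f i) (momentumRun γ β sg x₀ (fun s i => Y s i ω) (t + 1)).1‖
            ≤ Real.sqrt (2 * r * κ))}
      ≤ ENNReal.ofReal ((T + 1) * Real.exp (-r) + T * n * Real.exp (1 - 2 * r)) := by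
  have hγ0 : 0 < γ := by nlinarith
  have hn' : (0 : ℝ) < n := by exact_mod_cast hn
  set A : ℕ → Set Ω := fun t =>
    {ω | momentumLyapunov f γ β (x₀, 0) + t * (2 * γ * β * κ / n) + 128 * γ * κ / n * r
        < momentumLyapunov f γ β (momentumRun γ β sg x₀ (fun s i => Y s i ω) t)
          + γ / 2 * sumSqGrad f γ β sg x₀ (fun s i => Y s i ω) t} with hA
  set B : ℕ → Fin n → Set Ω := fun t i =>
    {ω | 2 * r * κ < ‖sg i (momentumRun γ β sg x₀ (fun s i => Y s i ω) (t + 1)).1 (Y t i ω)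
          - gradient (f i) (momentumRun γ β sg x₀ (fun s i => Y s i ω) (t + 1)).1‖ ^ 2} with hB
  have hAm : ∀ t ∈ Finset.range (T + 1), μ (A t) ≤ ENNReal.ofReal (Real.exp (-r)) := fun t ht =>
    measure_momentumLyapunov_gt_le hn hκ hL hβ hβ1 hγ hf ho hY
      (by have := Finset.mem_range.1 ht; omega) r
  have hBm : ∀ t ∈ Finset.range T, ∀ i ∈ (Finset.univ : Finset (Fin n)),
      μ (B t i) ≤ ENNReal.ofReal (Real.exp (1 - 2 * r)) := fun t ht i _ =>
    measure_noise_gt_le hκ hf ho hY (Finset.mem_range.1 ht) i (2 * r)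
      -- This map gives the next iterate, where the sample `Y t` is queried.
      (X := fun s => s.1 - γ • average s.2) (by fun_prop)
  have hsub : {ω | ¬ ((∀ t ≤ T,
          momentumLyapunov f γ β (momentumRun γ β sg x₀ (fun s i => Y s i ω) t)
          + γ / 2 * sumSqGrad f γ β sg x₀ (fun s i => Y s i ω) t ≤ 2 * Δ) ∧
        ∀ t < T, ∀ i, ‖sg i (momentumRun γ β sg x₀ (fun s i => Y s i ω) (t + 1)).1 (Y t i ω)
          - gradient (f i) (momentumRun γ β sg x₀ (fun s i => Y s i ω) (t + 1)).1‖
            ≤ Real.sqrt (2 * r * κ))}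
      ⊆ (⋃ t ∈ Finset.range (T + 1), A t) ∪ ⋃ t ∈ Finset.range T, ⋃ i ∈ Finset.univ, B t i := by
    intro ω hω
    by_contra hcon
    simp only [Set.mem_union, Set.mem_iUnion, not_or, not_exists, Finset.mem_range,
      Finset.mem_univ, hA, hB, Set.mem_ofPred_eq, not_lt] at hcon
    refine hω ⟨fun t ht => ?_, fun t ht i => ?_⟩
    · refine (hcon.1 t (by omega)).trans ?_
      -- The budget `2Δ` is split into `Δ` at the start, `Δ/2` for the accumulated drift and `Δ/2`
      -- for the deviation.
      have h1 : (t : ℝ) * (2 * γ * β * κ / n) ≤ Δ / 2 := by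
        have h0 : (t : ℝ) * (2 * γ * β * κ / n) ≤ T * (2 * γ * β * κ / n) := by gcongr
        have h2 : T * (2 * γ * β * κ / n) = (β ^ 2 * T * κ) / (6 * L * n) := by
          rw [← hγ]; field_simp; ring
        rw [h2] at h0
        refine h0.trans ?_
        rw [div_le_iff₀ (by positivity)]
        linarith
      have h2 : 128 * γ * κ / n * r ≤ Δ / 2 := by
        have h2 : 128 * γ * κ / n * r = (64 * β * κ * r) / (6 * L * n) := by
          rw [← hγ]; field_simp; ring
        rw [h2, div_le_iff₀ (by positivity)]
        linarith
      linarith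
    · exact Real.le_sqrt_of_sq_le (hcon.2 t ht i trivial)
  refine (measure_mono hsub).trans ((measure_union_le _ _).trans ?_)
  rw [ENNReal.ofReal_add (by positivity) (by positivity)]
  refine add_le_add ?_ ?_
  · refine (measure_biUnion_finset_le _ _).trans ((Finset.sum_le_sum hAm).trans ?_)
    rw [Finset.sum_const, Finset.card_range, nsmul_eq_mul, ENNReal.ofReal_mul (by positivity)]
    gcongr
    rw [← Nat.cast_succ, ENNReal.ofReal_natCast]
  · refine (measure_biUnion_finset_le _ _).trans ((Finset.sum_le_sum fun t ht =>
      (measure_biUnion_finset_le _ _).trans (Finset.sum_le_sum (hBm t ht))).trans ?_)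
    rw [Finset.sum_const, Finset.sum_const, Finset.card_range, Finset.card_univ, Fintype.card_fin,
      nsmul_eq_mul, nsmul_eq_mul, ENNReal.ofReal_mul (by positivity),
      ENNReal.ofReal_mul (by positivity), ENNReal.ofReal_natCast, ENNReal.ofReal_natCast, mul_assoc]

theorem exp_neg_logFactor {α : ℝ} (hα : 0 < α) (hn : 0 < n) :
    Real.exp (-logFactor α n T) = α / (16 * ((T : ℝ) + 1) * n) := by
  have hn' : (0 : ℝ) < n := by exact_mod_cast hn
  rw [Real.exp_neg, logFactor, Real.exp_log (by positivity), inv_div]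

/-- With `q = exp(-ℓ)`, the Lyapunov events cost at most `α/16`. The noise events cost `e q · (T n
q) ≤ 3 α/16`, since `q ≤ 1`. -/
theorem failure_probability_le {α : ℝ} (hα : 0 < α) (hα1 : α < 1) (hn : 0 < n) :
    ((T : ℝ) + 1) * Real.exp (-logFactor α n T) + T * n * Real.exp (1 - 2 * logFactor α n T)
      ≤ α := by
  have hn' : (1 : ℝ) ≤ n := by exact_mod_cast hn
  have h := exp_neg_logFactor (T := T) hα hn
  have h2 : Real.exp (1 - 2 * logFactor α n T)
      = Real.exp 1 * (α / (16 * ((T : ℝ) + 1) * n)) ^ 2 := by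
    rw [← h, ← Real.exp_nat_mul, ← Real.exp_add]; congr 1; push_cast; ring
  rw [h2, h]
  have he : Real.exp 1 ≤ 3 := by linarith [Real.exp_one_lt_d9]
  have hT : (0 : ℝ) ≤ T := by positivity
  have h3 : ((T : ℝ) + 1) * (α / (16 * ((T : ℝ) + 1) * n)) ≤ α / 16 := by
    have : ((T : ℝ) + 1) * (α / (16 * ((T : ℝ) + 1) * n)) = α / 16 / n := by field_simp
    rw [this]
    exact div_le_self (by positivity) hn'
  set q := α / (16 * ((T : ℝ) + 1) * n) with hq
  have hq0 : 0 < q := by positivity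
  have h4 : ((T : ℝ) + 1) * n * q = α / 16 := by rw [hq]; field_simp
  have h5 : q ≤ 1 := by
    rw [hq, div_le_one (by positivity)]
    nlinarith
  have h6 : (T : ℝ) * n * q ≤ α / 16 := by
    rw [← h4]; gcongr; linarith
  have h7 : (T : ℝ) * n * (Real.exp 1 * q ^ 2) = Real.exp 1 * q * (T * n * q) := by ring
  rw [h7]
  have h8 : Real.exp 1 * q * (T * n * q) ≤ 3 * 1 * (α / 16) := by gcongr
  linarith

end ByzClip

-- From the hyperparameter restrictions to the guarantee for the algorithm.

namespace ByzClip

variable {d n : ℕ} {Ξ Ω : Type*} [MeasurableSpace Ξ] [MeasurableSpace Ω] {μ : Measure Ω}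
  {T G : ℕ} {D : Fin n → Measure Ξ}
  {f : Fin n → RVec d → ℝ} {sg : Fin n → RVec d → Ξ → RVec d} {L Δ σ τ M α κ γ β : ℝ}
  {x₀ : RVec d} {ξ : ℕ → Fin n → Ω → Ξ} {W byz : ℕ → Fin n → Ω → RVec d}
  {RAgg : (Fin n → RVec d) → RVec d}

theorem one_le_logFactor (hα : 0 < α) (hα1 : α < 1) (hG : 1 ≤ G) : 1 ≤ logFactor α G T := by
  have hG' : (1 : ℝ) ≤ G := by exact_mod_cast hG
  have hT : (0 : ℝ) ≤ T := by positivity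
  rw [logFactor, Real.le_log_iff_exp_le (by positivity), le_div_iff₀ hα]
  have he : Real.exp 1 ≤ 3 := by linarith [Real.exp_one_lt_d9]
  have h0 := Real.exp_pos 1
  nlinarith [mul_nonneg hT (by linarith : (0 : ℝ) ≤ G)]

theorem bConst_nonneg (hσ : 0 ≤ σ) : 0 ≤ bConst σ α G T := by unfold bConst; positivity

theorem three_mul_le_bInit : 3 * τ ≤ bInit σ τ M α G T := le_max_left _ _

theorem add_bConst_le_bInit : M + bConst σ α G T ≤ bInit σ τ M α G T := le_max_right _ _

/-- Since `B ≥ 3τ`, `B - τ ≥ 2B/3`, which turns `mom_b` into a bound on `β B` itself. -/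
theorem HyperRestrictions.mul_bInit_le (H : HyperRestrictions L Δ σ τ M α G T γ β) :
    13 * (β * bInit σ τ M α G T) ≤ τ := by
  have h1 := H.mom_b
  have h2 := three_mul_le_bInit (σ := σ) (τ := τ) (M := M) (α := α) (G := G) (T := T)
  have h3 := H.beta_pos
  nlinarith

/-- The variance proxy of the noise; without noise it may be any small positive number. -/
theorem HyperRestrictions.exists_variance_proxy (H : HyperRestrictions L Δ σ τ M α G T γ β)
    (hL : 0 < L) (hΔ : 0 < Δ) (hσ : 0 ≤ σ) (hτ : 0 < τ) (hα : 0 < α) (hα1 : α < 1)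
    (hG : 1 ≤ G) (hdev : 64 * β * σ ^ 2 * logFactor α G T ≤ 3 * L * Δ * G) :
    ∃ κ : ℝ, 0 < κ ∧ (σ = 0 ∨ 0 < σ ∧ κ = σ ^ 2) ∧ β ^ 2 * T * κ ≤ 3 * L * Δ * G ∧
      64 * β * κ * logFactor α G T ≤ 3 * L * Δ * G ∧
      β * (M + 2 * Real.sqrt (2 * logFactor α G T * κ) + Real.sqrt (L * Δ)) ≤ τ := by
  have hβ := H.beta_pos
  have hβ1 := H.beta_le_one
  have hℓ := one_le_logFactor (T := T) hα hα1 hG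
  have hB := H.mul_bInit_le
  have hMB := add_bConst_le_bInit (σ := σ) (τ := τ) (M := M) (α := α) (G := G) (T := T)
  have hb0 := bConst_nonneg (α := α) (G := G) (T := T) hσ
  have hM' : β * M ≤ β * bInit σ τ M α G T := by gcongr; linarith
  have ha := H.mom_a
  have hG' : (1 : ℝ) ≤ G := by exact_mod_cast hG
  set ℓ := logFactor α G T with hℓdef
  rcases hσ.eq_or_lt with h0 | h0
  -- Without noise, the first term secures the drift and deviation budgets; the second makes the
  -- artificial noise level `√(2ℓz)` at most `τ/4`.
  · set z := min (3 * L * Δ * G / (64 * ((T : ℝ) + 1) * ℓ)) (τ ^ 2 / (32 * ℓ)) with hz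
    have hz0 : 0 < z := by
      refine lt_min ?_ ?_ <;> positivity
    have hz1 : z * (64 * ((T : ℝ) + 1) * ℓ) ≤ 3 * L * Δ * G :=
      (le_div_iff₀ (by positivity)).1 (min_le_left _ _)
    have hz2 : z * (32 * ℓ) ≤ τ ^ 2 := (le_div_iff₀ (by positivity)).1 (min_le_right _ _)
    have hs : Real.sqrt (2 * ℓ * z) ≤ τ / 4 := by
      rw [Real.sqrt_le_left (by positivity)]
      nlinarith
    have hT : (0 : ℝ) ≤ T := by positivity
    refine ⟨z, hz0, .inl h0.symm, ?_, ?_, ?_⟩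
    · refine le_trans ?_ hz1
      have h1 : β ^ 2 * T * z ≤ 1 * (64 * ((T : ℝ) + 1) * ℓ) * z := by
        have : β ^ 2 ≤ 1 := by nlinarith
        have h2 : (T : ℝ) ≤ 64 * ((T : ℝ) + 1) * ℓ := by nlinarith
        rw [one_mul]
        refine mul_le_mul_of_nonneg_right ?_ hz0.le
        nlinarith
      linarith
    · refine le_trans ?_ hz1
      have h1 : 64 * β * z * ℓ ≤ 64 * ((T : ℝ) + 1) * z * ℓ := by gcongr; linarith
      linarith
    · have h1 : β * Real.sqrt (2 * ℓ * z) ≤ 1 * (τ / 4) := by gcongr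
      linarith
  · have hbs : bConst σ α G T = Real.sqrt (2 * ℓ * σ ^ 2) := by
      rw [Real.sqrt_mul (by positivity), Real.sqrt_sq hσ, mul_comm]; rfl
    refine ⟨σ ^ 2, by positivity, .inr ⟨h0, rfl⟩, ?_, hdev, ?_⟩
    · have h1 := H.mom_one₃
      -- Thus `mom_one₃` already contains the drift budget.
      have h2 : 2 * σ ^ 2 ≤ cHat σ α T ^ 2 := by
        have h3 : Real.sqrt 2 * σ ≤ cHat σ α T := by
          unfold cHat
          gcongr
          have : 0 ≤ Real.sqrt (3 * Real.log (8 * ((T : ℝ) + 1) / α)) := Real.sqrt_nonneg _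
          linarith
        calc 2 * σ ^ 2 = (Real.sqrt 2 * σ) ^ 2 := by rw [mul_pow, Real.sq_sqrt (by norm_num)]
          _ ≤ _ := by gcongr
      have h4 : β ^ 2 * (12 * T * (2 * σ ^ 2)) ≤ L * Δ * G := le_trans (by gcongr) h1
      have : 0 ≤ L * Δ * G := by positivity
      have : 0 ≤ β ^ 2 * T * σ ^ 2 := by positivity
      linarith
    · have hc := H.mom_c
      rw [← hbs]
      linarith

theorem StochGradAssumption.subGaussianOracle (h : StochGradAssumption Finset.univ f D sg σ)
    (hD : ∀ i, IsProbabilityMeasure (D i)) (hκ : σ = 0 ∨ 0 < σ ∧ κ = σ ^ 2) :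
    SubGaussianOracle f D sg κ where
  measurable i := h.measurable i (Finset.mem_univ i)
  integrable i := h.integrable i (Finset.mem_univ i)
  unbiased i := h.unbiased i (Finset.mem_univ i)
  subGaussian i x := by
    rcases hκ with h0 | ⟨h0, rfl⟩
    · have := hD i
      refine normSubGaussian_of_ae_eq_zero ?_ κ
      filter_upwards [h.noiseless h0 i (Finset.mem_univ i) x] with s hs
      simp [hs]
    · exact h.subGaussian h0 i (Finset.mem_univ i) x

theorem multivariateGaussian_zero_cov :
    multivariateGaussian (0 : RVec d) ((0 : ℝ) ^ 2 • (1 : Matrix (Fin d) (Fin d) ℝ))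
      = Measure.dirac 0 := by
  simp [multivariateGaussian]

theorem RandomnessAssumption.noise_ae_eq_zero
    (h : RandomnessAssumption T Finset.univ D 0 μ ξ W) :
    ∀ᵐ ω ∂μ, ∀ t < T, ∀ i, W (t + 1) i ω = 0 := by
  rw [ae_all_iff]; intro t
  by_cases ht : t < T
  · simp only [ht, true_imp_iff]
    rw [ae_all_iff]; intro i
    have hl := h.noise_law t ht i (Finset.mem_univ i)
    refine ae_of_ae_map (p := fun w => w = 0) hl.aemeasurable ?_
    rw [hl.map_eq, multivariateGaussian_zero_cov, ae_dirac_eq]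
    exact Filter.eventually_pure.2 rfl
  · simp [ht]

variable [IsProbabilityMeasure μ]

/-- The samples may be replaced by measurable ones. -/
theorem RandomnessAssumption.exists_indepSamples {σω : ℝ}
    (h : RandomnessAssumption T Finset.univ D σω μ ξ W) :
    ∃ Y : ℕ → Fin n → Ω → Ξ, IndepSamples T D μ Y ∧
      ∀ᵐ ω ∂μ, ∀ t < T, ∀ i, ξ (t + 1) i ω = Y t i ω := by
  obtain ⟨ω₀⟩ : Nonempty Ω := nonempty_of_isProbabilityMeasure μ
  have hm : ∀ t < T, ∀ i, AEMeasurable (ξ (t + 1) i) μ := fun t ht i =>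
    (h.sample_law t ht i (Finset.mem_univ i)).aemeasurable
  -- Samples are only almost everywhere measurable, and only below the horizon; beyond it a constant
  -- is substituted. The index shifts from `t + 1` to `t`.
  refine ⟨fun t i => if ht : t < T then (hm t ht i).mk else fun _ => ξ (t + 1) i ω₀,
    ⟨fun t i => ?_, fun t ht i => ?_, ?_⟩, ?_⟩
  · split_ifs with ht
    · exact (hm t ht i).measurable_mk
    · exact measurable_const
  · simp only [ht, dif_pos]
    rw [← Measure.map_congr (hm t ht i).ae_eq_mk]
    exact (h.sample_law t ht i (Finset.mem_univ i)).map_eq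
  · have hinj : Function.Injective fun p : Fin T × Fin n =>
        ((p.1, ⟨p.2, Finset.mem_univ p.2⟩) : Fin T × {i // i ∈ (Finset.univ : Finset (Fin n))}) := by
      intro p q hpq
      simp only [Prod.mk.injEq, Subtype.mk.injEq] at hpq
      exact Prod.ext hpq.1 hpq.2
    have h1 := (h.indep_clients.comp (fun _ z => z.1) fun _ => measurable_fst).precomp hinj
    refine h1.congr fun p => ?_
    filter_upwards [(hm p.1 p.1.2 p.2).ae_eq_mk] with ω hω
    simp only [Fin.is_lt, dif_pos]
    exact hω
  · rw [ae_all_iff]; intro t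
    by_cases ht : t < T
    · simp only [ht, true_imp_iff, dif_pos]
      rw [ae_all_iff]; intro i
      exact (hm t ht i).ae_eq_mk
    · simp [ht]

/-- For zero Byzantine clients the robustness bound, applied to the set of all clients, has
right-hand side zero. -/
theorem IsRobustAggregator.eq_average {c : ℝ} (h : IsRobustAggregator (n := n) 0 c RAgg)
    (y : Fin n → RVec d) : RAgg y = average y := by
  have h1 := h.2.2 y Finset.univ (by simp)
  rw [Nat.cast_zero, zero_div, mul_zero, zero_div, zero_mul, Finset.card_univ, Fintype.card_fin] at h1
  have h2 : ‖RAgg y - average y‖ = 0 := by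
    have := le_antisymm h1 (sq_nonneg _)
    exact pow_eq_zero_iff (two_ne_zero) |>.1 this
  exact sub_eq_zero.1 (norm_eq_zero.1 h2)

/-- Only the averaged momentum error is kept, with half its coefficient; the clipping terms are
nonnegative. -/
theorem momentumLyapunov_init_le (hγ : 0 < γ) (hβ : 0 < β) {η : ℝ} (hη : 0 < η) :
    momentumLyapunov f γ β (x₀, 0) ≤ lyapunov Finset.univ f γ β 1 η (initState x₀) := by
  have e : (1 / ((Finset.univ : Finset (Fin n)).card : ℝ)) • ∑ i, (initState (n := n) x₀).v i
      = average (0 : Fin n → RVec d) := by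
    rw [Finset.card_univ, Fintype.card_fin]; rfl
  unfold momentumLyapunov lyapunov
  rw [e]
  simp only [initState]
  set u := ‖average (0 : Fin n → RVec d) - gradient (globalLoss Finset.univ f) x₀‖ ^ 2
  have h1 : 0 ≤ γ / β * u := by positivity
  have h2 : 2 * γ / β * u = 2 * (γ / β * u) := by ring
  rw [h2]
  have h3 : 0 ≤ 8 * γ * β / (1 ^ 2 * η ^ 2) * (1 / ((Finset.univ : Finset (Fin n)).card : ℝ) *
      ∑ i, ‖(0 : RVec d) - gradient (f i) x₀‖ ^ 2) := by positivity
  have h4 : 0 ≤ 2 * γ / (1 * η) * (1 / ((Finset.univ : Finset (Fin n)).card : ℝ) *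
      ∑ i : Fin n, ‖(0 : RVec d) - 0‖ ^ 2) := by positivity
  linarith

/-- The convergence guarantee for given hyperparameters. -/
theorem HyperRestrictions.avgSqGrad_le (H : HyperRestrictions L Δ σ τ M α n T γ β)
    (hL : 0 < L) (hΔ : 0 < Δ) (hσ : 0 ≤ σ) (hτ : 0 < τ) (hα : 0 < α) (hα1 : α < 1)
    (hn : 1 ≤ n) (hT : 1 ≤ T) (hdev : 64 * β * σ ^ 2 * logFactor α n T ≤ 3 * L * Δ * n)
    (hR : ∀ y, RAgg y = average y) (hf : SmoothAssumption Finset.univ f L)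
    (hsg : StochGradAssumption Finset.univ f D sg σ)
    (hrand : RandomnessAssumption T Finset.univ D 0 μ ξ W)
    (hM : ∀ i, ‖gradient (f i) x₀‖ ≤ M) (hlyap : momentumLyapunov f γ β (x₀, 0) ≤ Δ) :
    ENNReal.ofReal (1 - α) ≤
      μ {ω | avgSqGrad Finset.univ f T (run Finset.univ RAgg γ β 1 τ sg x₀ ξ W byz ω)
        ≤ 4 * Δ / (γ * T)} := by
  obtain ⟨κ, hκ, hκσ, hdrift, hdev', hclip⟩ := H.exists_variance_proxy hL hΔ hσ hτ hα hα1 hn hdev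
  have hD : ∀ i, IsProbabilityMeasure (D i) := fun i => by
    have hl := hrand.sample_law 0 hT i (Finset.mem_univ i)
    rw [← hl.map_eq]
    exact Measure.isProbabilityMeasure_map hl.aemeasurable
  have ho := hsg.subGaussianOracle hD hκσ
  obtain ⟨Y, hY, hYξ⟩ := hrand.exists_indepSamples
  have hW := hrand.noise_ae_eq_zero
  have hγ := H.gamma_pos
  have hT' : (0 : ℝ) < T := by exact_mod_cast hT
  have hbad := measure_not_controlled_le (x₀ := x₀) hn hκ hL H.beta_pos H.beta_le_one H.beta_eq hf
    ho hY hlyap hdrift hdev'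
  set good : Set Ω := {ω |
    (∀ t ≤ T, momentumLyapunov f γ β (momentumRun γ β sg x₀ (fun s i => Y s i ω) t)
          + γ / 2 * sumSqGrad f γ β sg x₀ (fun s i => Y s i ω) t ≤ 2 * Δ) ∧
        ∀ t < T, ∀ i, ‖sg i (momentumRun γ β sg x₀ (fun s i => Y s i ω) (t + 1)).1 (Y t i ω)
          - gradient (f i) (momentumRun γ β sg x₀ (fun s i => Y s i ω) (t + 1)).1‖
            ≤ Real.sqrt (2 * logFactor α n T * κ)} with hgood
  have hbad' : μ goodᶜ ≤ ENNReal.ofReal α :=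
    hbad.trans (ENNReal.ofReal_le_ofReal (failure_probability_le hα hα1 hn))
  -- Subadditivity is enough, so `good` need not be measurable.
  have hgood' : ENNReal.ofReal (1 - α) ≤ μ good := by
    rw [ENNReal.ofReal_sub _ hα.le, ENNReal.ofReal_one, tsub_le_iff_right]
    calc (1 : ℝ≥0∞) = μ (good ∪ goodᶜ) := by rw [Set.union_compl_self, measure_univ]
      _ ≤ μ good + μ goodᶜ := measure_union_le _ _
      _ ≤ _ := by gcongr
  refine hgood'.trans (measure_mono_ae ?_)
  filter_upwards [hYξ, hW] with ω hωY hωW hω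
  set y : ℕ → Fin n → Ξ := fun s i => Y s i ω with hy
  have hsum0 : ∀ t, 0 ≤ γ / 2 * sumSqGrad f γ β sg x₀ y t := fun t => by
    have : 0 ≤ sumSqGrad f γ β sg x₀ y t := Finset.sum_nonneg fun _ _ => by positivity
    positivity
  have hinc := fun t ht i => (norm_momentum_increment_le hn hL H.beta_pos H.beta_le_one H.beta_eq hf
    hΔ.le hM (Real.sqrt_nonneg _) (y := y) (fun t ht => by linarith [hω.1 t ht, hsum0 t])
    hω.2 i t ht).trans hclip
  have hrun := run_eq_momentumRun hR hωW hωY hinc (byz := byz)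
  have havg : avgSqGrad Finset.univ f T (run Finset.univ RAgg γ β 1 τ sg x₀ ξ W byz ω)
      = 1 / T * sumSqGrad f γ β sg x₀ y T := by
    unfold avgSqGrad sumSqGrad
    congr 1
    refine Finset.sum_congr rfl fun t ht => ?_
    rw [hrun t (Finset.mem_range.1 ht).le]
  change avgSqGrad _ _ _ _ ≤ _
  rw [havg]
  have hfin := hω.1 T le_rfl
  -- Dropping the final Lyapunov value leaves `∑ ‖∇f‖² ≤ 4Δ/γ`.
  have hpos : 0 ≤ momentumLyapunov f γ β (momentumRun γ β sg x₀ y T) := by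
    have h1 := ciInf_le hf.bddBelow (momentumRun γ β sg x₀ y T).1
    have h2 := H.beta_pos
    unfold momentumLyapunov
    have : 0 ≤ γ / β * ‖average (momentumRun γ β sg x₀ y T).2
      - gradient (globalLoss Finset.univ f) (momentumRun γ β sg x₀ y T).1‖ ^ 2 := by positivity
    linarith
  have h3 : γ / 2 * sumSqGrad f γ β sg x₀ y T ≤ 2 * Δ := by linarith
  rw [le_div_iff₀ (by positivity)]
  have h4 : 1 / T * sumSqGrad f γ β sg x₀ y T * (γ * T)
      = 2 * (γ / 2 * sumSqGrad f γ β sg x₀ y T) := by field_simp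
  linarith

end ByzClip

-- Choice of the momentum.

namespace ByzClip

variable {L Δ σ τ M α : ℝ} {G T : ℕ}

/-- The reciprocal momentum, up to a logarithmic factor. -/
def inverseMomentum (L Δ σ τ B : ℝ) (G T : ℕ) : ℝ :=
  T / (L * Δ) * (mainRate L Δ σ τ B G T + hiddenTerms L Δ σ τ B T)

/-- After rescaling, the summands appear as lower bounds for `1/β`. The term `√(LΔ)/τ` serves
`mom_a`, `B/τ` serves `stepsize`, `mom_b` and `mom_c`, and the two roots serve `mom_one₂` and
`mom_one₁`. The term with `√G` serves `mom_one₃`, the martingale terms and the deviation budget. -/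
theorem inverseMomentum_eq (hL : 0 < L) (hΔ : 0 < Δ) (hG : 1 ≤ G) (hT : 1 ≤ T) (B : ℝ) :
    inverseMomentum L Δ σ τ B G T = (1 + B / τ)
      + σ * Real.sqrt T * (Real.sqrt (L * Δ) + B + σ) / (L * Δ * Real.sqrt G)
      + (Real.sqrt (L * Δ) / τ
      + ((T : ℝ) * σ ^ 2 * B ^ 2 / (L * Δ * τ ^ 2)) ^ (1 / 4 : ℝ)
      + ((T : ℝ) * σ ^ 2 * B / (L * Δ * τ)) ^ (1 / 3 : ℝ)) := by
  have hT' : (0 : ℝ) < T := by exact_mod_cast hT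
  have hG' : (0 : ℝ) < G := by exact_mod_cast hG
  unfold inverseMomentum mainRate leadingRate hiddenTerms
  rw [Real.sqrt_mul hG'.le]
  have h1 : (T : ℝ) = Real.sqrt T * Real.sqrt T := (Real.mul_self_sqrt hT'.le).symm
  have h2 : 0 < Real.sqrt T := Real.sqrt_pos.2 hT'
  have h3 : 0 < Real.sqrt G := Real.sqrt_pos.2 hG'
  have h4 : (T : ℝ) / (L * Δ) * (σ * (Real.sqrt (L * Δ) + B + σ) / (Real.sqrt G * Real.sqrt T))
      = σ * Real.sqrt T * (Real.sqrt (L * Δ) + B + σ) / (L * Δ * Real.sqrt G) := by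
    generalize Real.sqrt (L * Δ) = s
    nth_rewrite 1 [h1]
    field_simp
  have h5 : ∀ z : ℝ, (T : ℝ) / (L * Δ) * (L * Δ * z / T) = z := fun z => by field_simp
  have h6 : ∀ z : ℝ, (T : ℝ) / (L * Δ) * (L * Δ / T * z) = z := fun z => by field_simp
  rw [mul_add, mul_add, h4, h5, h6]

/-- The larger constant `20` is absorbed by squaring the argument of `ℓ`, so the logarithm at most
doubles; then `3 · 2ℓ ≤ (3ℓ)²`. -/
theorem one_add_bOne_le (hα : 0 < α) (hα1 : α < 1) (hG : 1 ≤ G) :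
    1 + bOne α T ≤ 4 * logFactor α G T := by
  have hℓ := one_le_logFactor (T := T) hα hα1 hG
  have hG' : (1 : ℝ) ≤ G := by exact_mod_cast hG
  have hlog : Real.log (20 * ((T : ℝ) + 1) / α) ≤ 2 * logFactor α G T := by
    have : Real.log (20 * ((T : ℝ) + 1) / α)
        ≤ Real.log ((16 * ((T : ℝ) + 1) * G / α) ^ 2) := by
      refine Real.log_le_log (by positivity) ?_
      rw [div_pow, div_le_div_iff₀ hα (by positivity)]
      have hT : (0 : ℝ) ≤ T := by positivity
      have h1 : α ^ 2 ≤ 1 * α := by nlinarith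
      have h2 : 20 * ((T : ℝ) + 1) ≤ (16 * ((T : ℝ) + 1) * G) ^ 2 := by
        have h3 : 16 * ((T : ℝ) + 1) * 1 ≤ 16 * ((T : ℝ) + 1) * G := by gcongr
        nlinarith
      calc 20 * ((T : ℝ) + 1) * α ^ 2 ≤ 20 * ((T : ℝ) + 1) * (1 * α) := by gcongr
        _ = 20 * ((T : ℝ) + 1) * α := by ring
        _ ≤ _ := by gcongr
    rw [Real.log_pow, Nat.cast_ofNat] at this
    exact this
  have : bOne α T ≤ 3 * logFactor α G T := by
    unfold bOne
    rw [Real.sqrt_le_left (by positivity)]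
    nlinarith
  linarith

theorem bOne_nonneg : 0 ≤ bOne α T := Real.sqrt_nonneg _

theorem cHat_le (hσ : 0 ≤ σ) (hα : 0 < α) (hα1 : α < 1) (hG : 1 ≤ G) :
    cHat σ α T ≤ 6 * logFactor α G T * σ := by
  have hℓ := one_le_logFactor (T := T) hα hα1 hG
  have hG' : (1 : ℝ) ≤ G := by exact_mod_cast hG
  have hlog : Real.log (8 * ((T : ℝ) + 1) / α) ≤ logFactor α G T := by
    refine Real.log_le_log (by positivity) ?_
    have hT : (0 : ℝ) ≤ T := by positivity
    refine div_le_div_of_nonneg_right ?_ hα.le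
    nlinarith
  have h1 : Real.sqrt (3 * Real.log (8 * ((T : ℝ) + 1) / α)) ≤ 2 * logFactor α G T := by
    rw [Real.sqrt_le_left (by positivity)]
    nlinarith
  have h2 : Real.sqrt 2 ≤ 2 := by rw [Real.sqrt_le_left (by norm_num)]; norm_num
  unfold cHat
  gcongr
  linarith

theorem inv_pow_mul_le {Y A D : ℝ} (hY : 0 < Y) (p : ℕ) (h : D ≤ A * Y ^ p) :
    (1 / Y) ^ p * D ≤ A := by
  rw [one_div, inv_pow, inv_mul_le_iff₀ (by positivity), mul_comm]
  exact h

theorem inv_mul_le {Y A D : ℝ} (hY : 0 < Y) (h : D ≤ A * Y) : 1 / Y * D ≤ A := by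
  rw [one_div, inv_mul_le_iff₀ hY, mul_comm]
  exact h

/-- Each power of `η` is compensated by a power of `Y`, so a condition linear in `Y` implies the
restrictions of higher degree in `β`. -/
theorem le_pow_mul_pow {η Y : ℝ} (hη : 1 ≤ η * Y) (hY : 1 ≤ Y) (k m : ℕ) :
    Y ≤ η ^ k * Y ^ (k + 1 + m) := by
  have h1 : 1 ≤ (η * Y) ^ k := one_le_pow₀ hη
  have h2 : 1 ≤ Y ^ m := one_le_pow₀ hY
  calc Y = 1 * 1 * Y := by ring
    _ ≤ (η * Y) ^ k * Y ^ m * Y := by gcongr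
    _ = _ := by rw [mul_pow]; ring

/-- The restrictions from the martingale terms hold once `Y = 1 / β` dominates the `1/√(GT)` term
of the rate. -/
theorem martingale_restriction {η Y Λ q ℓ P S s B a : ℝ} (hη : 1 ≤ η * Y)
    (hY : 1 ≤ Y) (hΛ : 0 ≤ Λ) (hq : 0 ≤ q) (hℓ : 0 ≤ ℓ) (hYq : 1000 * (ℓ * q) ≤ Y) (ha0 : 0 ≤ a)
    (ha : a ≤ 4 * ℓ) (hP : 0 ≤ P) (hqΛ : P * (s + B) ≤ q * Λ) (hS0 : 0 ≤ S) {c₁ c₂ c₃ : ℝ}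
    (hc₁ : 0 ≤ c₁) (hc₂ : 0 ≤ c₂) (hc₃ : 0 ≤ c₃) (hS : S ≤ c₂ * (s + B))
    (hc : 6 * c₁ * c₂ ≤ 1000 * c₃) (k m : ℕ) :
    c₁ * (Real.sqrt 2 * a * P * S) ≤ c₃ * Λ * (η ^ k * Y ^ (k + 1 + m)) := by
  have hsqrt2 : Real.sqrt 2 ≤ 3 / 2 := by
    rw [Real.sqrt_le_left (by norm_num)]; norm_num
  have hZ : 0 ≤ ℓ * q * Λ := by positivity
  calc c₁ * (Real.sqrt 2 * a * P * S)
      ≤ c₁ * (3 / 2 * (4 * ℓ) * P * (c₂ * (s + B))) := by gcongr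
    _ = 6 * c₁ * c₂ * (ℓ * (P * (s + B))) := by ring
    _ ≤ 6 * c₁ * c₂ * (ℓ * (q * Λ)) := by gcongr
    _ = 6 * c₁ * c₂ * (ℓ * q * Λ) := by ring
    _ ≤ 1000 * c₃ * (ℓ * q * Λ) := by gcongr
    _ = c₃ * Λ * (1000 * (ℓ * q)) := by ring
    _ ≤ c₃ * Λ * (η ^ k * Y ^ (k + 1 + m)) := by
      exact mul_le_mul_of_nonneg_left (hYq.trans (le_pow_mul_pow hη hY k m)) (by positivity)

/-- The restrictions from the client noise hold once `Y = 1 / β` dominates the corresponding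
higher-order term of the rate. -/
theorem noise_restriction {Y h ℓ V A : ℝ} {p : ℕ} (hp : p ≠ 0) (hh : 0 ≤ h) (hℓ : 1 ≤ ℓ)
    (hV : 0 ≤ V) (hA : 0 ≤ A) (hYh : 1000 * ℓ * h ≤ Y) (hpow : A * h ^ p = V) :
    1000 * ℓ * V ≤ A * Y ^ p := by
  calc 1000 * ℓ * V ≤ (1000 * ℓ) ^ p * V := by
        gcongr
        exact le_self_pow₀ (by linarith) hp
    _ = A * (1000 * ℓ * h) ^ p := by rw [← hpow]; ring
    _ ≤ A * Y ^ p := by gcongr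

theorem bConst_sq (hα : 0 < α) (hα1 : α < 1) (hG : 1 ≤ G) :
    bConst σ α G T ^ 2 = 2 * logFactor α G T * σ ^ 2 := by
  have hℓ := one_le_logFactor (T := T) hα hα1 hG
  unfold bConst; rw [mul_pow, Real.sq_sqrt (by positivity)]; ring

theorem rpow_one_div_pow {z : ℝ} (hz : 0 ≤ z) {p : ℕ} (hp : p ≠ 0) :
    (z ^ (1 / (p : ℝ))) ^ p = z := by
  rw [one_div]; exact Real.rpow_inv_natCast_pow hz hp

/-- The momentum `1 / (1000 ℓ R)`, with `R` the sum of the terms of the rate, satisfies all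
restrictions. -/
theorem hyperRestrictions_inverseMomentum (hL : 0 < L) (hΔ : 0 < Δ) (hσ : 0 ≤ σ) (hτ : 0 < τ)
    (hM : 0 ≤ M) (hα : 0 < α) (hα1 : α < 1) (hG : 1 ≤ G) (hT : 1 ≤ T) {β : ℝ}
    (hβ : β = 1 / (1000 * logFactor α G T
      * inverseMomentum L Δ σ τ (bInit σ τ M α G T) G T)) :
    HyperRestrictions L Δ σ τ M α G T (β / (12 * L)) β ∧
      64 * β * σ ^ 2 * logFactor α G T ≤ 3 * L * Δ * G := by
  have hℓ := one_le_logFactor (T := T) hα hα1 hG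
  have hT1 : (1 : ℝ) ≤ T := by exact_mod_cast hT
  have hG1 : (1 : ℝ) ≤ G := by exact_mod_cast hG
  have hB3 := three_mul_le_bInit (σ := σ) (τ := τ) (M := M) (α := α) (G := G) (T := T)
  have hMB := add_bConst_le_bInit (σ := σ) (τ := τ) (M := M) (α := α) (G := G) (T := T)
  have hb0 := bConst_nonneg (α := α) (G := G) (T := T) hσ
  have ha0 : 0 ≤ bOne α T := bOne_nonneg
  have ha := one_add_bOne_le (T := T) hα hα1 hG
  have hR := inverseMomentum_eq (σ := σ) (τ := τ) hL hΔ hG hT (bInit σ τ M α G T)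
  have hs0 : 0 < Real.sqrt (L * Δ) := Real.sqrt_pos.2 (by positivity)
  have hw1 : 1 ≤ Real.sqrt T := Real.one_le_sqrt.2 hT1
  have hg1 : 1 ≤ Real.sqrt G := Real.one_le_sqrt.2 hG1
  have hB0 : 0 < bInit σ τ M α G T := by linarith
  have hη0 : 0 < etaConst σ τ M α G T := div_pos hτ hB0
  have hηB : etaConst σ τ M α G T * (bInit σ τ M α G T / τ) = 1 := by
    unfold etaConst; field_simp
  set q := σ * Real.sqrt T * (Real.sqrt (L * Δ) + bInit σ τ M α G T + σ)
    / (L * Δ * Real.sqrt G) with hq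
  have hq0 : 0 ≤ q := by positivity
  have hqΛ : σ * Real.sqrt T * (Real.sqrt (L * Δ) + bInit σ τ M α G T + σ)
      = q * (L * Δ * Real.sqrt G) := by rw [hq]; field_simp
  have hqΛ' : σ * Real.sqrt T * (Real.sqrt (L * Δ) + bInit σ τ M α G T)
      ≤ q * (L * Δ * Real.sqrt G) := by
    rw [← hqΛ]
    exact mul_le_mul_of_nonneg_left (by linarith) (by positivity)
  set h4 := ((T : ℝ) * σ ^ 2 * bInit σ τ M α G T ^ 2 / (L * Δ * τ ^ 2)) ^ (1 / 4 : ℝ) with hh4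
  set h3 := ((T : ℝ) * σ ^ 2 * bInit σ τ M α G T / (L * Δ * τ)) ^ (1 / 3 : ℝ) with hh3
  have h40 : 0 ≤ h4 := by positivity
  have h30 : 0 ≤ h3 := by positivity
  have h4pow : L * Δ * etaConst σ τ M α G T ^ 2 * h4 ^ 4 = T * σ ^ 2 := by
    have h := rpow_one_div_pow (z := (T : ℝ) * σ ^ 2 * bInit σ τ M α G T ^ 2 / (L * Δ * τ ^ 2))
      (by positivity) (p := 4) (by norm_num)
    rw [Nat.cast_ofNat] at h
    rw [hh4, h, etaConst]
    field_simp
  have h3pow : L * Δ * etaConst σ τ M α G T * h3 ^ 3 = T * σ ^ 2 := by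
    have h := rpow_one_div_pow (z := (T : ℝ) * σ ^ 2 * bInit σ τ M α G T / (L * Δ * τ))
      (by positivity) (p := 3) (by norm_num)
    rw [Nat.cast_ofNat] at h
    rw [hh3, h, etaConst]
    field_simp
  have hBτ : 0 < bInit σ τ M α G T / τ := by positivity
  have hsτ : 0 < Real.sqrt (L * Δ) / τ := by positivity
  set Y := 1000 * logFactor α G T * inverseMomentum L Δ σ τ (bInit σ τ M α G T) G T with hY
  have hYR : ∀ z, z ≤ inverseMomentum L Δ σ τ (bInit σ τ M α G T) G T →
      1000 * logFactor α G T * z ≤ Y := fun z hz => by rw [hY]; gcongr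
  have hY1 := hYR 1 (by linarith)
  have hYB := hYR (bInit σ τ M α G T / τ) (by linarith)
  have hYq := hYR q (by linarith)
  have hYs := hYR (Real.sqrt (L * Δ) / τ) (by linarith)
  have hY4 := hYR h4 (by linarith)
  have hY3 := hYR h3 (by linarith)
  have hℓz : ∀ z, 0 ≤ z → 1000 * z ≤ 1000 * logFactor α G T * z := fun z hz => by
    gcongr
    linarith
  have hY1' : 1000 ≤ Y := by linarith
  have hY0 : 0 < Y := by linarith
  have hYone : 1 ≤ Y := by linarith
  have hηY : 1000 ≤ etaConst σ τ M α G T * Y := by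
    have h1 := mul_le_mul_of_nonneg_left ((hℓz _ hBτ.le).trans hYB) hη0.le
    rwa [mul_left_comm, hηB, mul_one] at h1
  have hηY1 : 1 ≤ etaConst σ τ M α G T * Y := by linarith
  have hτB : 1000 * bInit σ τ M α G T ≤ τ * Y := by
    have h1 := mul_le_mul_of_nonneg_left ((hℓz _ hBτ.le).trans hYB) hτ.le
    rwa [mul_left_comm, mul_div_cancel₀ _ hτ.ne'] at h1
  have hτs : 1000 * Real.sqrt (L * Δ) ≤ τ * Y := by
    have h1 := mul_le_mul_of_nonneg_left ((hℓz _ hsτ.le).trans hYs) hτ.le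
    rwa [mul_left_comm, mul_div_cancel₀ _ hτ.ne'] at h1
  -- Below, `k` is the power of `η` in the restriction and `k + 1 + m` is the power of `β`.
  have hmart := fun {S c₁ c₂ c₃ : ℝ} (hS0 : 0 ≤ S) (hc₁ : 0 ≤ c₁) (hc₂ : 0 ≤ c₂) (hc₃ : 0 ≤ c₃)
      (hS : S ≤ c₂ * (Real.sqrt (L * Δ) + bInit σ τ M α G T)) (hc : 6 * c₁ * c₂ ≤ 1000 * c₃) =>
    martingale_restriction hηY1 hYone (by positivity) hq0 (by linarith) (by linarith)
      (by linarith : 0 ≤ 1 + bOne α T) ha (by positivity) hqΛ' hS0 hc₁ hc₂ hc₃ hS hc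
  have hS1 : 0 ≤ 4 * Real.sqrt (L * Δ)
      + 3 / 2 * (bInit σ τ M α G T - τ + bConst σ α G T) := by linarith
  have hS2 : 0 ≤ 12 * Real.sqrt (L * Δ)
      + 3 * (bInit σ τ M α G T - τ + bConst σ α G T) := by linarith
  have hβ0 : 0 < β := by rw [hβ]; positivity
  have hβ1 : β ≤ 1 / 1000 := by rw [hβ]; gcongr
  have hb2 := bConst_sq (σ := σ) (T := T) hα hα1 hG
  have hV0 : 0 ≤ logFactor α G T * (T * σ ^ 2) := by positivity
  refine ⟨⟨by positivity, hβ0, by linarith, ?_, by field_simp, ?_, ?_, ?_, ?_, ?_, ?_, ?_, ?_, ?_,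
    ?_, ?_, ?_, ?_, ?_⟩, ?_⟩
  · rw [div_le_div_iff₀ (by positivity) (by positivity)]
    nlinarith only [hβ1, hL]
  · have hβη : β / etaConst σ τ M α G T ≤ 1 / 1000 := by
      rw [hβ, div_div, mul_comm]
      gcongr
    generalize etaConst σ τ M α G T = η at hη0 hβη
    have e : 5 / 6 - 32 * L ^ 2 * β ^ 2 / η ^ 2 * (β / (12 * L)) ^ 2
        - 96 * L ^ 2 / η ^ 2 * (β / (12 * L)) ^ 2
        = 5 / 6 - (32 * β ^ 2 + 96) / 144 * (β / η) ^ 2 := by field_simp; ring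
    have h2 : (β / η) ^ 2 ≤ (1 / 1000) ^ 2 := by gcongr
    have h3 : β ^ 2 ≤ 1 := by nlinarith only [hβ0, hβ1]
    rw [e]
    nlinarith only [sq_nonneg (β / η), h2, h3]
  · rw [hβ]; exact inv_mul_le hY0 (by linarith)
  · rw [hβ]; exact inv_mul_le hY0 (by linarith)
  · rw [hβ]; exact inv_mul_le hY0 (by linarith)
  · rw [hβ]
    refine inv_pow_mul_le hY0 3 (le_trans ?_ (noise_restriction (by norm_num) h30 hℓ
      (by positivity) (by positivity) hY3 h3pow))
    rw [hb2]
    linarith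
  · rw [hβ]
    refine inv_pow_mul_le hY0 4 (le_trans ?_ (noise_restriction (by norm_num) h40 hℓ
      (by positivity) (by positivity) hY4 h4pow))
    rw [hb2]
    linarith
  · rw [hβ]
    refine inv_pow_mul_le hY0 2 ?_
    have hc := cHat_le (T := T) hσ hα hα1 hG
    have hc0 : 0 ≤ cHat σ α T := by unfold cHat; positivity
    have hs2 : Real.sqrt (L * Δ) ^ 2 = L * Δ := Real.sq_sqrt (by positivity)
    have hw2 : Real.sqrt T ^ 2 = (T : ℝ) := Real.sq_sqrt (by positivity)
    have hg2 : Real.sqrt G ^ 2 = (G : ℝ) := Real.sq_sqrt (by positivity)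
    -- Only the summand `√(LΔ)` of the leading rate is needed here; one factor of it cancels.
    have h1 : σ * Real.sqrt T ≤ q * Real.sqrt (L * Δ) * Real.sqrt G := by
      refine le_of_mul_le_mul_right ?_ hs0
      calc σ * Real.sqrt T * Real.sqrt (L * Δ)
          ≤ σ * Real.sqrt T * (Real.sqrt (L * Δ) + bInit σ τ M α G T) := by gcongr; linarith
        _ ≤ q * (L * Δ * Real.sqrt G) := hqΛ'
        _ = q * (Real.sqrt (L * Δ) ^ 2 * Real.sqrt G) := by rw [hs2]
        _ = _ := by ring
    calc 12 * T * cHat σ α T ^ 2 ≤ 12 * T * (6 * logFactor α G T * σ) ^ 2 := by gcongr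
      _ = 432 * logFactor α G T ^ 2 * (σ * Real.sqrt T) ^ 2 := by rw [mul_pow σ, hw2]; ring
      _ ≤ 1000 ^ 2 * logFactor α G T ^ 2 * (q * Real.sqrt (L * Δ) * Real.sqrt G) ^ 2 := by
        gcongr; norm_num
      _ = L * Δ * G * (1000 * logFactor α G T * q) ^ 2 := by
        rw [mul_pow _ (Real.sqrt G), mul_pow _ (Real.sqrt (L * Δ)), hs2, hg2]; ring
      _ ≤ _ := by gcongr
  · rw [hβ]
    refine inv_pow_mul_le hY0 2 ?_
    refine le_trans (le_of_eq (by ring)) ((hmart (c₁ := 8) (c₂ := 1) (c₃ := 3) hB0.le (by norm_num) (by norm_num) (by norm_num)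
      (by linarith) (by norm_num) 1 0).trans
      (le_of_eq (by ring)))
  · rw [hβ]
    refine inv_pow_mul_le hY0 3 ?_
    refine le_trans (le_of_eq (by ring)) ((hmart (c₁ := 16) (c₂ := 4) (c₃ := 3) hS1 (by norm_num) (by norm_num) (by norm_num)
      (by linarith) (by norm_num) 1 1).trans
      (le_of_eq (by ring)))
  · rw [hβ]
    refine inv_pow_mul_le hY0 4 ?_
    refine le_trans (le_of_eq (by ring)) ((hmart (c₁ := 16) (c₂ := 12) (c₃ := 9) hS2 (by norm_num) (by norm_num) (by norm_num)
      (by linarith) (by norm_num) 1 2).trans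
      (le_of_eq (by ring)))
  · rw [hβ]
    refine inv_pow_mul_le hY0 3 ?_
    refine le_trans (le_of_eq (by ring)) ((hmart (c₁ := 64) (c₂ := 4) (c₃ := 3) hS1 (by norm_num) (by norm_num) (by norm_num)
      (by linarith) (by norm_num) 2 0).trans
      (le_of_eq (by ring)))
  · rw [hβ]
    refine inv_mul_le hY0 ?_
    refine le_trans (le_of_eq (by ring)) ((hmart (c₁ := 16) (c₂ := 4) (c₃ := 3) hS1 (by norm_num) (by norm_num) (by norm_num)
      (by linarith) (by norm_num) 0 0).trans
      (le_of_eq (by ring)))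
  · rw [hβ]
    refine inv_pow_mul_le hY0 4 ?_
    refine le_trans (le_of_eq (by ring)) ((hmart (c₁ := 16) (c₂ := 12) (c₃ := 9) hS2 (by norm_num) (by norm_num) (by norm_num)
      (by linarith) (by norm_num) 2 1).trans
      (le_of_eq (by ring)))
  · rw [hβ]
    refine inv_pow_mul_le hY0 2 ?_
    refine le_trans (le_of_eq (by ring)) ((hmart (c₁ := 4) (c₂ := 12) (c₃ := 9) hS2 (by norm_num) (by norm_num) (by norm_num)
      (by linarith) (by norm_num) 0 1).trans
      (le_of_eq (by ring)))
  · have h1 : 64 * β * σ ^ 2 * logFactor α G T = 1 / Y * (64 * σ ^ 2 * logFactor α G T) := by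
      rw [hβ]; ring
    rw [h1]
    refine inv_mul_le hY0 ?_
    -- The deviation budget comes from the summand `σ` of the leading rate.
    have h2 : σ ^ 2 ≤ q * (L * Δ * Real.sqrt G) := by
      rw [← hqΛ]
      calc σ ^ 2 = σ * 1 * (0 + 0 + σ) := by ring
        _ ≤ _ := by gcongr
    have h3 : L * Δ * Real.sqrt G ≤ L * Δ * G := by
      gcongr
      rw [Real.sqrt_le_left (by positivity)]
      nlinarith only [hG1]
    have h0 : 0 ≤ logFactor α G T * q := by positivity
    calc 64 * σ ^ 2 * logFactor α G T
        ≤ 64 * (q * (L * Δ * Real.sqrt G)) * logFactor α G T := by gcongr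
      _ = 64 * (logFactor α G T * q) * (L * Δ * Real.sqrt G) := by ring
      _ ≤ 3 * Y * (L * Δ * G) := by
        exact mul_le_mul (by linarith) h3 (by positivity) (by positivity)
      _ = _ := by ring

end ByzClip

-- Large horizons.

namespace ByzClip

variable {L Δ σ τ M α : ℝ} {G T : ℕ}

/-- `B` grows like `√(log T)`. The exponent `1/8` is small enough that the largest hidden factor `(T
B)^(1/3)` stays within `T^(3/8)`, below the critical `T^(1/2)`. -/
theorem bInit_le (hσ : 0 ≤ σ) (hτ : 0 < τ) (hM : 0 ≤ M) (hα : 0 < α) (hα1 : α < 1) (hG : 1 ≤ G) :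
    ∃ c : ℝ, 0 < c ∧ ∀ T : ℕ, 1 ≤ T → bInit σ τ M α G T ≤ c * (T : ℝ) ^ (1 / 8 : ℝ) := by
  have hG1 : (1 : ℝ) ≤ G := by exact_mod_cast hG
  set k : ℝ := (32 * G / α) ^ (1 / 4 : ℝ) with hk
  have hk0 : 0 ≤ k := by positivity
  refine ⟨3 * τ + M + Real.sqrt (8 * k) * σ, by positivity, fun T hT => ?_⟩
  have hT1 : (1 : ℝ) ≤ T := by exact_mod_cast hT
  set u := (T : ℝ) ^ (1 / 8 : ℝ) with hu
  have hu1 : 1 ≤ u := Real.one_le_rpow hT1 (by norm_num)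
  have hu2 : (T : ℝ) ^ (1 / 4 : ℝ) = u ^ 2 := by
    rw [hu, ← Real.rpow_natCast, ← Real.rpow_mul (by positivity)]; norm_num
  have hℓ : logFactor α G T ≤ 4 * k * u ^ 2 := by
    have h1 := Real.log_le_rpow_div (x := 16 * ((T : ℝ) + 1) * G / α) (ε := 1 / 4)
      (by positivity) (by norm_num)
    have h2 : (16 * ((T : ℝ) + 1) * G / α) ^ (1 / 4 : ℝ) ≤ (32 * G / α * T) ^ (1 / 4 : ℝ) := by
      refine Real.rpow_le_rpow (by positivity) ?_ (by norm_num)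
      have : 32 * G / α * T = 32 * T * G / α := by ring
      rw [this]
      refine div_le_div_of_nonneg_right ?_ hα.le
      refine mul_le_mul_of_nonneg_right ?_ (by linarith)
      linarith
    rw [Real.mul_rpow (by positivity) (by positivity), hu2] at h2
    unfold logFactor
    linarith
  have hb : bConst σ α G T ≤ Real.sqrt (8 * k) * σ * u := by
    have h1 : Real.sqrt (2 * logFactor α G T) ≤ Real.sqrt (8 * k) * u := by
      calc Real.sqrt (2 * logFactor α G T) ≤ Real.sqrt (8 * k * u ^ 2) :=
            Real.sqrt_le_sqrt (by linarith)
        _ = _ := by rw [Real.sqrt_mul (by positivity), Real.sqrt_sq (by linarith)]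
    calc bConst σ α G T ≤ σ * (Real.sqrt (8 * k) * u) := by unfold bConst; gcongr
      _ = _ := by ring
  have h1 : 3 * τ ≤ 3 * τ * u := le_mul_of_one_le_right (by positivity) hu1
  have h2 : M ≤ M * u := le_mul_of_one_le_right hM hu1
  have h3 : 0 ≤ Real.sqrt (8 * k) * σ * u := by positivity
  refine max_le ?_ ?_
  · have h4 : 0 ≤ M * u := by positivity
    linarith
  · have h4 : 0 ≤ 3 * τ * u := by positivity
    linarith

/-- A root of a polynomially bounded quantity. -/
theorem rpow_le_of_le_mul_pow {z A u : ℝ} {p m : ℕ} (hp : p ≠ 0) (hz : 0 ≤ z) (hA : 0 ≤ A)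
    (hu : 1 ≤ u) (hm : m ≤ 3 * p) (h : z ≤ A * u ^ m) :
    z ^ (1 / (p : ℝ)) ≤ (1 + A) * u ^ 3 := by
  rw [one_div]
  refine (Real.rpow_inv_le_iff_of_pos hz (by positivity) (by positivity)).2 ?_
  rw [Real.rpow_natCast]
  calc z ≤ A * u ^ m := h
    _ ≤ (1 + A) ^ p * u ^ (3 * p) := by
      gcongr
      exact (by linarith : A ≤ 1 + A).trans (le_self_pow₀ (by linarith) hp)
    _ = ((1 + A) * u ^ 3) ^ p := by rw [mul_pow, ← pow_mul]

/-- For large horizons all terms but the `1/√(GT)` term are negligible. -/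
theorem exists_horizon (hL : 0 < L) (hΔ : 0 < Δ) (hσ : 0 < σ) (hτ : 0 < τ) (hM : 0 ≤ M)
    (hα : 0 < α) (hα1 : α < 1) (hG : 1 ≤ G) :
    ∃ T₀ : ℕ, ∀ T : ℕ, 1 ≤ T → T₀ ≤ T →
      L * Δ * (1 + bInit σ τ M α G T / τ) / T + hiddenTerms L Δ σ τ (bInit σ τ M α G T) T
        ≤ σ * σ / Real.sqrt ((G : ℝ) * T) := by
  have hG1 : (1 : ℝ) ≤ G := by exact_mod_cast hG
  obtain ⟨c, hc, hB⟩ := bInit_le hσ.le hτ hM hα hα1 hG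
  set s := Real.sqrt (L * Δ) with hs
  have hs0 : 0 ≤ s := Real.sqrt_nonneg _
  set A₄ := σ ^ 2 * c ^ 2 / (L * Δ * τ ^ 2) with hA₄
  set A₃ := σ ^ 2 * c / (L * Δ * τ) with hA₃
  have hA₄0 : 0 ≤ A₄ := by positivity
  have hA₃0 : 0 ≤ A₃ := by positivity
  set K := 1 + c / τ + s / τ + (1 + A₄) + (1 + A₃) with hK
  have hK0 : 0 < K := by positivity
  set N := L * Δ * K * Real.sqrt G / σ ^ 2 with hN
  have hN0 : 0 ≤ N := by positivity
  -- With `u = T^(1/8)`, the left side is at most `N σ²/(√G u⁵)` and the right side is `σ²/(√G u⁴)`,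
  -- so `u ≥ N` is what is required.
  refine ⟨⌈N ^ 8⌉₊, fun T hT hNT => ?_⟩
  have hT1 : (1 : ℝ) ≤ T := by exact_mod_cast hT
  have hBT := hB T hT
  have hB0 : 0 ≤ bInit σ τ M α G T := by
    have := three_mul_le_bInit (σ := σ) (τ := τ) (M := M) (α := α) (G := G) (T := T)
    linarith
  unfold hiddenTerms
  rw [← hs]
  set B := bInit σ τ M α G T
  set u := (T : ℝ) ^ (1 / 8 : ℝ) with hu
  have hu1 : 1 ≤ u := Real.one_le_rpow hT1 (by norm_num)
  have hu8 : u ^ 8 = T := by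
    rw [hu, ← Real.rpow_natCast, ← Real.rpow_mul (by positivity)]; norm_num
  have hNu : N ≤ u := by
    have h1 : N ^ 8 ≤ u ^ 8 := by rw [hu8]; exact Nat.ceil_le.1 hNT
    exact le_of_pow_le_pow_left₀ (by norm_num) (by linarith) h1
  have hu3 : 1 ≤ u ^ 3 := one_le_pow₀ hu1
  have hu13 : u ≤ u ^ 3 := le_self_pow₀ hu1 (by norm_num)
  have h4 : ((T : ℝ) * σ ^ 2 * B ^ 2 / (L * Δ * τ ^ 2)) ^ (1 / 4 : ℝ) ≤ (1 + A₄) * u ^ 3 := by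
    have := rpow_le_of_le_mul_pow (p := 4) (m := 10) (by norm_num)
      (z := (T : ℝ) * σ ^ 2 * B ^ 2 / (L * Δ * τ ^ 2)) (by positivity) hA₄0 hu1 (by norm_num) (by
        calc (T : ℝ) * σ ^ 2 * B ^ 2 / (L * Δ * τ ^ 2)
            ≤ (T : ℝ) * σ ^ 2 * (c * u) ^ 2 / (L * Δ * τ ^ 2) := by gcongr
          _ = _ := by rw [hA₄, ← hu8]; ring)
    rwa [Nat.cast_ofNat] at this
  have h3 : ((T : ℝ) * σ ^ 2 * B / (L * Δ * τ)) ^ (1 / 3 : ℝ) ≤ (1 + A₃) * u ^ 3 := by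
    have := rpow_le_of_le_mul_pow (p := 3) (m := 9) (by norm_num)
      (z := (T : ℝ) * σ ^ 2 * B / (L * Δ * τ)) (by positivity) hA₃0 hu1 (by norm_num) (by
        calc (T : ℝ) * σ ^ 2 * B / (L * Δ * τ)
            ≤ (T : ℝ) * σ ^ 2 * (c * u) / (L * Δ * τ) := by gcongr
          _ = _ := by rw [hA₃, ← hu8]; ring)
    rwa [Nat.cast_ofNat] at this
  have hBτ : B / τ ≤ c / τ * u ^ 3 := by
    rw [div_mul_eq_mul_div]
    gcongr
    exact hBT.trans (by gcongr)
  have hsτ : s / τ ≤ s / τ * u ^ 3 := le_mul_of_one_le_right (by positivity) hu3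
  have hsqrt : Real.sqrt ((G : ℝ) * T) = Real.sqrt G * u ^ 4 := by
    rw [Real.sqrt_mul (by positivity), ← hu8]
    congr 1
    rw [show u ^ 8 = (u ^ 4) ^ 2 by ring]
    exact Real.sqrt_sq (by positivity)
  have hg0 : 0 < Real.sqrt (G : ℝ) := Real.sqrt_pos.2 (by linarith)
  rw [hsqrt]
  calc L * Δ * (1 + B / τ) / T + L * Δ / T * (s / τ
        + ((T : ℝ) * σ ^ 2 * B ^ 2 / (L * Δ * τ ^ 2)) ^ (1 / 4 : ℝ)
        + ((T : ℝ) * σ ^ 2 * B / (L * Δ * τ)) ^ (1 / 3 : ℝ))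
      = L * Δ / T * (1 + B / τ + s / τ
        + ((T : ℝ) * σ ^ 2 * B ^ 2 / (L * Δ * τ ^ 2)) ^ (1 / 4 : ℝ)
        + ((T : ℝ) * σ ^ 2 * B / (L * Δ * τ)) ^ (1 / 3 : ℝ)) := by ring
    _ ≤ L * Δ / T * (K * u ^ 3) := by
      refine mul_le_mul_of_nonneg_left ?_ (by positivity)
      have : K * u ^ 3 = u ^ 3 + c / τ * u ^ 3 + s / τ * u ^ 3 + (1 + A₄) * u ^ 3
        + (1 + A₃) * u ^ 3 := by rw [hK]; ring
      linarith
    _ = N * (σ ^ 2 / (Real.sqrt G * u ^ 5)) := by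
      rw [hN, ← hu8]
      field_simp
    _ ≤ u * (σ ^ 2 / (Real.sqrt G * u ^ 5)) := by gcongr
    _ = σ * σ / (Real.sqrt G * u ^ 4) := by field_simp

/-- Here `B = M + b` with `b ≤ 2ℓσ`, and the leading rate already contains `σ`; removing `b` costs
one logarithm. -/
theorem leadingRate_bInit_le (hσ : 0 ≤ σ) (hM : 0 ≤ M) (hα : 0 < α) (hα1 : α < 1) (hG : 1 ≤ G)
    (hMτ : 3 * τ < M) :
    leadingRate L Δ σ (bInit σ τ M α G T) G T
      ≤ 3 * logFactor α G T * leadingRate L Δ σ M G T := by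
  have hℓ := one_le_logFactor (T := T) hα hα1 hG
  have hb0 := bConst_nonneg (α := α) (G := G) (T := T) hσ
  have hB : bInit σ τ M α G T = M + bConst σ α G T := max_eq_right (by linarith)
  have hb : bConst σ α G T ≤ 2 * logFactor α G T * σ := by
    unfold bConst
    rw [mul_comm]
    gcongr
    rw [Real.sqrt_le_left (by positivity)]
    nlinarith
  unfold leadingRate
  rw [← mul_div_assoc]
  refine div_le_div_of_nonneg_right ?_ (Real.sqrt_nonneg _)
  rw [hB, mul_left_comm]
  refine mul_le_mul_of_nonneg_left ?_ hσ
  have hs := Real.sqrt_nonneg (L * Δ)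
  have h1 := mul_le_mul_of_nonneg_right hℓ hs
  have h2 := mul_le_mul_of_nonneg_right hℓ hM
  have h3 := mul_le_mul_of_nonneg_right hℓ hσ
  linarith

theorem reg_eq_univ {n : ℕ} {reg : Finset (Fin n)} (hreg : 1 ≤ reg.card)
    (h : byzFraction reg = 0) : reg = Finset.univ := by
  unfold byzFraction at h
  rcases div_eq_zero_iff.1 h with h | h
  · rw [Nat.cast_eq_zero, Finset.card_eq_zero] at h
    exact Finset.compl_eq_empty_iff _ |>.1 h
  · have h1 := Finset.card_le_univ reg
    rw [Fintype.card_fin] at h1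
    have : n = 0 := by exact_mod_cast h
    omega

end ByzClip

end

-- Assembly of the four bounds.

theorem corollary2 :
    ∃ (C : ℝ) (k : ℕ), 0 < C ∧
      ∀ (L Δ σ τ M α : ℝ) (G : ℕ), 0 < L → 0 < Δ → 0 ≤ σ → 0 < τ → 0 ≤ M → 0 < α → α < 1 →
        1 ≤ G →
      ∃ T₀ : ℕ, ∀ T : ℕ, 1 ≤ T →
      ∃ γ β : ℝ, ByzClip.HyperRestrictions L Δ σ τ M α G T γ β ∧
      ∀ (d n : ℕ) (reg : Finset (Fin n)) (f : Fin n → RVec d → ℝ) (x₀ : RVec d)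
        (Ξ : Type*) [MeasurableSpace Ξ] (D : Fin n → Measure Ξ)
        (sg : Fin n → RVec d → Ξ → RVec d)
        (Ω : Type*) [MeasurableSpace Ω] (μ : Measure Ω) [IsProbabilityMeasure μ]
        (ξ : ℕ → Fin n → Ω → Ξ) (W byz : ℕ → Fin n → Ω → RVec d)
        (c σω : ℝ) (RAgg : (Fin n → RVec d) → RVec d),
        reg.card = G →
        -- no Byzantine clients and no privacy noise
        ByzClip.byzFraction reg = 0 → σω = 0 →
        ByzClip.IsRobustAggregator (regᶜ).card c RAgg →
        ByzClip.SmoothAssumption reg f L →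
        ByzClip.StochGradAssumption reg f D sg σ →
        ByzClip.RandomnessAssumption T reg D σω μ ξ W →
        IsGreatest ((fun i => ‖gradient (f i) x₀‖) '' (reg : Set (Fin n))) M →
        ByzClip.lyapunov reg f γ β 1 (ByzClip.etaConst σ τ M α G T) (ByzClip.initState x₀) ≤ Δ →
        -- the bound, with the hidden higher-order terms written out, for every horizon
        (ENNReal.ofReal (1 - α) ≤
          μ {ω | ByzClip.avgSqGrad reg f T (ByzClip.run reg RAgg γ β 1 τ sg x₀ ξ W byz ω) ≤
            C * ByzClip.logFactor α G T ^ k *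
              (ByzClip.mainRate L Δ σ τ (ByzClip.bInit σ τ M α G T) G T +
                ByzClip.hiddenTerms L Δ σ τ (ByzClip.bInit σ τ M α G T) T)}) ∧
        -- the bound without the hidden terms, for large horizons
        (0 < σ → T₀ ≤ T → ENNReal.ofReal (1 - α) ≤
          μ {ω | ByzClip.avgSqGrad reg f T (ByzClip.run reg RAgg γ β 1 τ sg x₀ ξ W byz ω) ≤
            C * ByzClip.logFactor α G T ^ k *
              ByzClip.mainRate L Δ σ τ (ByzClip.bInit σ τ M α G T) G T}) ∧
        -- the same with the initial gradient norm `M` alone, when it exceeds `3τ`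
        (0 < σ → T₀ ≤ T → 3 * τ < M → ENNReal.ofReal (1 - α) ≤
          μ {ω | ByzClip.avgSqGrad reg f T (ByzClip.run reg RAgg γ β 1 τ sg x₀ ξ W byz ω) ≤
            C * ByzClip.logFactor α G T ^ k * ByzClip.mainRate L Δ σ τ M G T}) ∧
        -- the `1/√(GT)` rate
        (0 < σ → T₀ ≤ T → ENNReal.ofReal (1 - α) ≤
          μ {ω | ByzClip.avgSqGrad reg f T (ByzClip.run reg RAgg γ β 1 τ sg x₀ ξ W byz ω) ≤
            C * ByzClip.logFactor α G T ^ k *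
              ByzClip.leadingRate L Δ σ (ByzClip.bInit σ τ M α G T) G T}) := by
  -- `288000 = 6 · 48000`: `48000 = 4 · 12 · 1000` comes from `4Δ/(γT)`, a factor `2` from absorbing
  -- the lower-order terms and `3` from replacing `B` by `M`. One power of `ℓ` comes from `β`, the
  -- other from that replacement.
  refine ⟨288000, 2, by norm_num, ?_⟩
  intro L Δ σ τ M α G hL hΔ hσ hτ hM hα hα1 hG
  have hhor : ∃ T₀ : ℕ, 0 < σ → ∀ T : ℕ, 1 ≤ T → T₀ ≤ T →
      L * Δ * (1 + ByzClip.bInit σ τ M α G T / τ) / T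
        + ByzClip.hiddenTerms L Δ σ τ (ByzClip.bInit σ τ M α G T) T
        ≤ σ * σ / Real.sqrt ((G : ℝ) * T) := by
    by_cases h : 0 < σ
    · obtain ⟨T₀, h₀⟩ := ByzClip.exists_horizon hL hΔ h hτ hM hα hα1 hG
      exact ⟨T₀, fun _ => h₀⟩
    · exact ⟨0, fun h' => absurd h' h⟩
  obtain ⟨T₀, hT₀⟩ := hhor
  refine ⟨T₀, fun T hT => ?_⟩
  have hT1 : (1 : ℝ) ≤ T := by exact_mod_cast hT
  have hB0 : 0 ≤ ByzClip.bInit σ τ M α G T :=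
    le_trans (by positivity) (ByzClip.three_mul_le_bInit (τ := τ))
  have hℓ := ByzClip.one_le_logFactor (T := T) hα hα1 hG
  obtain ⟨β, hβ⟩ : ∃ β : ℝ, β = 1 / (1000 * ByzClip.logFactor α G T
      * ByzClip.inverseMomentum L Δ σ τ (ByzClip.bInit σ τ M α G T) G T) := ⟨_, rfl⟩
  obtain ⟨H, hdev⟩ := ByzClip.hyperRestrictions_inverseMomentum hL hΔ hσ hτ hM hα hα1 hG hT hβ
  refine ⟨β / (12 * L), β, H, ?_⟩
  intro d n reg f x₀ Ξ _ D sg Ω _ μ _ ξ W byz c σω RAgg hcard hbyz hσω hR hf hsg hrand hgr hlyap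
  obtain rfl := ByzClip.reg_eq_univ (hcard ▸ hG) hbyz
  obtain rfl : n = G := by rwa [Finset.card_univ, Fintype.card_fin] at hcard
  subst hσω
  rw [Finset.compl_univ, Finset.card_empty] at hR
  have hη : 0 < ByzClip.etaConst σ τ M α n T :=
    div_pos hτ (lt_of_lt_of_le (by positivity) (ByzClip.three_mul_le_bInit (τ := τ)))
  have key := H.avgSqGrad_le (byz := byz) hL hΔ hσ hτ hα hα1 hG hT hdev hR.eq_average hf hsg hrand
    (fun i => hgr.2 ⟨i, Finset.mem_coe.2 (Finset.mem_univ i), rfl⟩)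
    ((ByzClip.momentumLyapunov_init_le H.gamma_pos H.beta_pos hη).trans hlyap)
  have hmono : ∀ {r : ℝ}, 48000 * ByzClip.logFactor α n T *
      (ByzClip.mainRate L Δ σ τ (ByzClip.bInit σ τ M α n T) n T +
        ByzClip.hiddenTerms L Δ σ τ (ByzClip.bInit σ τ M α n T) T) ≤ r →
      ENNReal.ofReal (1 - α) ≤ μ {ω | ByzClip.avgSqGrad Finset.univ f T
        (ByzClip.run Finset.univ RAgg (β / (12 * L)) β 1 τ sg x₀ ξ W byz ω) ≤ r} := by
    intro r hr
    refine key.trans (measure_mono fun ω hω => le_trans (le_trans hω (le_of_eq ?_)) hr)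
    have hRpos := H.beta_pos
    rw [hβ, one_div_pos, ByzClip.inverseMomentum] at hRpos
    rw [hβ, ByzClip.inverseMomentum]
    set R := ByzClip.mainRate L Δ σ τ (ByzClip.bInit σ τ M α n T) n T +
        ByzClip.hiddenTerms L Δ σ τ (ByzClip.bInit σ τ M α n T) T
    have hR0 : R ≠ 0 := by
      intro h0
      rw [h0] at hRpos
      simp at hRpos
    have hT0 : (T : ℝ) ≠ 0 := by positivity
    field_simp
    norm_num
  have hs0 := Real.sqrt_nonneg (L * Δ)
  -- The negligible terms are compared with the `σ · σ` part alone, which is present for every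
  -- nonnegative `B`.
  have hlead : ∀ B : ℝ, 0 ≤ B →
      σ * σ / Real.sqrt ((n : ℝ) * T) ≤ ByzClip.leadingRate L Δ σ B n T := fun B hB => by
    unfold ByzClip.leadingRate
    gcongr
    linarith
  have hlead0 : ∀ B : ℝ, 0 ≤ B → 0 ≤ ByzClip.leadingRate L Δ σ B n T := fun B hB =>
    le_trans (by positivity) (hlead B hB)
  have hhid0 : 0 ≤ ByzClip.hiddenTerms L Δ σ τ (ByzClip.bInit σ τ M α n T) T := by
    unfold ByzClip.hiddenTerms; positivity
  have hmain : ∀ B, ByzClip.mainRate L Δ σ τ B n T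
      = L * Δ * (1 + B / τ) / T + ByzClip.leadingRate L Δ σ B n T := fun _ => rfl
  have hfirst0 : ∀ B : ℝ, 0 ≤ B → 0 ≤ L * Δ * (1 + B / τ) / T := fun B hB => by positivity
  have hℓ2 : ByzClip.logFactor α n T ≤ ByzClip.logFactor α n T ^ 2 :=
    le_self_pow₀ hℓ (by norm_num)
  set ℓ := ByzClip.logFactor α n T with hℓdef
  set B := ByzClip.bInit σ τ M α n T with hBdef
  set hid := ByzClip.hiddenTerms L Δ σ τ B T with hhid
  have hbound : ∀ {r s : ℝ}, r ≤ s → 0 ≤ s → 48000 * ℓ * r ≤ 48000 * ℓ ^ 2 * s := by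
    intro r s hrs hs
    calc 48000 * ℓ * r ≤ 48000 * ℓ * s := by gcongr
      _ ≤ _ := by gcongr
  have hlarge : 0 < σ → T₀ ≤ T → ByzClip.mainRate L Δ σ τ B n T + hid
      ≤ 2 * ByzClip.leadingRate L Δ σ B n T := fun h0 hTT => by
    have h1 := hT₀ h0 T hT hTT
    have h2 := hlead B hB0
    rw [hmain]
    linarith
  have hl0 := hlead0 B hB0
  refine ⟨hmono ?_, fun h0 hTT => hmono ?_, fun h0 hTT hMτ => hmono ?_, fun h0 hTT => hmono ?_⟩
  · have h1 : 0 ≤ ByzClip.mainRate L Δ σ τ B n T + hid := by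
      rw [hmain]; linarith [hfirst0 B hB0]
    refine (hbound le_rfl h1).trans ?_
    gcongr
    norm_num
  · have h1 : 2 * ByzClip.leadingRate L Δ σ B n T ≤ 6 * ByzClip.mainRate L Δ σ τ B n T := by
      rw [hmain]; linarith [hfirst0 B hB0]
    refine (hbound ((hlarge h0 hTT).trans h1) (by linarith)).trans (le_of_eq (by ring))
  · have h1 := ByzClip.leadingRate_bInit_le (L := L) (Δ := Δ) (T := T) hσ hM hα hα1 hG hMτ
    have h2 : ByzClip.mainRate L Δ σ τ B n T + hid
        ≤ 6 * ℓ * ByzClip.mainRate L Δ σ τ M n T := by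
      refine (hlarge h0 hTT).trans ?_
      rw [hmain]
      have h3 := mul_nonneg (by linarith : 0 ≤ ℓ) (hfirst0 M hM)
      linarith
    calc 48000 * ℓ * (ByzClip.mainRate L Δ σ τ B n T + hid)
        ≤ 48000 * ℓ * (6 * ℓ * ByzClip.mainRate L Δ σ τ M n T) := by gcongr
      _ = _ := by ring
  · have h1 : 2 * ByzClip.leadingRate L Δ σ B n T ≤ 6 * ByzClip.leadingRate L Δ σ B n T := by
      linarith
    exact (hbound ((hlarge h0 hTT).trans h1) (by linarith)).trans (le_of_eq (by ring))
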